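/- Let $\mathrm{len}(x)$ be the bit length of $x$ ($\mathrm{len}(0)=0$). Let $\mathbf{I}\Delta_0+\Omega_1$ be the first-order theory in the language $\{0,1,+,\cdot,<\}$ whose axioms are those of $\mathrm{PA}^-$ (the nonnegative part of a discretely ordered commutative ring), induction for all bounded ($\Delta_0$) formulas with parameters, and $\Omega_1$: for every $x$ the number $x^{\mathrm{len}(x)}$ exists (the graph of $x\mapsto x^{\mathrm{len}(x)}$ being expressed by a bounded formula). Let $\mathbf{I}\Delta_0+\Omega_1^{\mathrm{fun}}$ be the version in which $x\mapsto x^{\mathrm{len}(x)}$ is a function symbol, which may occur in the induction formulas and in the bounds of their quantifiers. Let $T$ be the following classical theory with three sorts: numbers ($m,n,\dots$), functions ($f,g,\dots$, mapping numbers to numbers) and operators ($F,G,\dots$, mapping functions to functions). Function terms are function variables and $F(g)$, with $g$ a function term; number terms are built from number variables and $0,1$ by $+$, $\cdot$, $x\mapsto x^{\mathrm{len}(x)}$ and application $g(t)$ of a function term to a number term. The atomic formulas are $s=t$ and $s<t$ for number terms, and quantifiers over all three sorts are allowed. Write $\mu(m<t:\varphi(m))$ for the least $m<t$ with $\varphi(m)$,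 and for $t$ if there is none. *Bounded quantifier formulas* are built from atomic formulas by propositional connectives and by the quantifiers * $\forall z<S$ and $\exists z<S$, with $S$ a number term not containing $z$; * $\forall f$ and $\exists f$ restricted to $f$ with $\forall n\; f(n)=\mu(m<T_0(n):\varphi(m,n))$, where $\varphi$ is a bounded quantifier formula and $T_0$ a number term, neither of which uses $f$; * $\forall F$ and $\exists F$ restricted to $F$ with $\forall f\,\forall n\; F(f)(n)=\mu(m<T_0(n,f):\varphi(m,n,f))$, where $\varphi$ is a bounded quantifier formula and $T_0$ a number term, neither of which uses $F$. Here $m$ does not occur in $T_0$, and other parameters are allowed. The axioms of $T$ are the universal closures of: 1. the axioms of $\mathrm{PA}^-$ and the defining axiom of the function $x\mapsto x^{\mathrm{len}(x)}$; 2. induction for bounded quantifier formulas; 3. extensionality: $\forall n\, f(n)=g(n)\Rightarrow\forall m\, F(f)(m)=F(g)(m)$; 4. bounded quantifier comprehension: (a) $\exists f\,\forall n\; f(n)=\mu(m<T_0(n):\varphi(m,n))$ and (b) $\exists F\,\forall f\,\forall n\; F(f)(n)=\mu(m<T_0(n,f):\varphi(m,n,f))$, for all bounded quantifier formulas $\varphi$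 and number terms $T_0$ that do not use $f$ (in (a)), respectively $F$ (in (b)). Then $T$ is a conservative extension of $\mathbf{I}\Delta_0+\Omega_1$: for every sentence $\sigma$ of the first-order language $\{0,1,+,\cdot,<\}$, $T$ proves $\sigma$ (about its numbers) if and only if $\mathbf{I}\Delta_0+\Omega_1$ proves $\sigma$. Likewise, for every first-order sentence $\sigma$ of the language $\{0,1,+,\cdot,<,x\mapsto x^{\mathrm{len}(x)}\}$, $T$ proves $\sigma$ if and only if $\mathbf{I}\Delta_0+\Omega_1^{\mathrm{fun}}$ proves $\sigma$. -/

import Mathlib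

open FirstOrder FirstOrder.Language

namespace LimitedExp

/-! ## First-order bounded arithmetic -/

/-- Function symbols `0, 1, +, ·`, and, when the flag is `true`, also a unary symbol `om`
for the function `x ↦ x ^ len x`. -/
inductive ArithFunc : Bool → ℕ → Type
  | zero {b : Bool} : ArithFunc b 0
  | one {b : Bool} : ArithFunc b 0
  | add {b : Bool} : ArithFunc b 2
  | mul {b : Bool} : ArithFunc b 2
  | om : ArithFunc true 1

/-- The only relation symbol (besides equality) is `<`. -/
inductive ArithRel : ℕ → Type
  | lt : ArithRel 2

/-- `arith false` is the language `{0, 1, +, ·, <}` of arithmetic;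
`arith true` has in addition the unary function symbol `om`. -/
abbrev arith (b : Bool) : Language := ⟨ArithFunc b, ArithRel⟩

/-- Terms whose variables are `&0, …, &(n-1)`. -/
abbrev Tm (b : Bool) (n : ℕ) := (arith b).Term (Empty ⊕ Fin n)

/-- Formulas whose free variables are among `&0, …, &(n-1)`; a quantifier in front of a formula
in `Fm b (n+1)` binds `&n`. -/
abbrev Fm (b : Bool) (n : ℕ) := (arith b).BoundedFormula Empty n

section Build

variable {b : Bool} {n : ℕ}

instance : Zero (Tm b n) := ⟨Constants.term (L := arith b) ArithFunc.zero⟩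
instance : One (Tm b n) := ⟨Constants.term (L := arith b) ArithFunc.one⟩
instance : Add (Tm b n) := ⟨Functions.apply₂ (L := arith b) ArithFunc.add⟩
instance : Mul (Tm b n) := ⟨Functions.apply₂ (L := arith b) ArithFunc.mul⟩

/-- The term `x ^ len x`. -/
def omT (t : Tm true n) : Tm true n := Functions.apply₁ (L := arith true) ArithFunc.om t

/-- The variable `&i`. -/
def bv (i : Fin n) : Tm b n := Term.var (Sum.inr i)

/-- The last variable, which the next quantifier binds. -/
def lastV : Tm b (n + 1) := bv (Fin.last n)

/-- Regard a term as a term over one more variable. -/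
def up (t : Tm b n) : Tm b (n + 1) := t.relabel (Sum.map id Fin.castSucc)

/-- The atomic formula `t < s`. -/
def ltF (t s : Tm b n) : Fm b n :=
  Relations.boundedFormula₂ (L := arith b) ArithRel.lt t s

/-- `∀ x < t, φ`, where `t` does not contain `x`. -/
def ballF (t : Tm b n) (φ : Fm b (n + 1)) : Fm b n := ∀' ((ltF lastV (up t)) ⟹ φ)

/-- `∃ x < t, φ`, where `t` does not contain `x`. -/
def bexF (t : Tm b n) (φ : Fm b (n + 1)) : Fm b n := ∃' ((ltF lastV (up t)) ⊓ φ)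

/-- Simultaneous substitution of terms for the variables of a formula. -/
def inst {m : ℕ} (φ : Fm b n) (s : Fin n → Tm b m) : Fm b m :=
  (φ.toFormula.subst (Sum.elim Empty.elim s)).relabel (id : Empty ⊕ Fin m → Empty ⊕ Fin m)

/-- Bounded (`Δ₀`) formulas. -/
inductive IsDelta0 {b : Bool} : ∀ {n : ℕ}, Fm b n → Prop
  | falsum {n : ℕ} : IsDelta0 (⊥ : Fm b n)
  | equal {n : ℕ} (t s : Tm b n) : IsDelta0 (t =' s)
  | lt {n : ℕ} (t s : Tm b n) : IsDelta0 (ltF t s)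
  | imp {n : ℕ} {φ ψ : Fm b n} : IsDelta0 φ → IsDelta0 ψ → IsDelta0 (φ ⟹ ψ)
  | ball {n : ℕ} (t : Tm b n) {φ : Fm b (n + 1)} : IsDelta0 φ → IsDelta0 (ballF t φ)
  | bex {n : ℕ} (t : Tm b n) {φ : Fm b (n + 1)} : IsDelta0 φ → IsDelta0 (bexF t φ)

end Build

/-- The axioms of `PA⁻`: nonnegative parts of discretely ordered commutative rings. -/
inductive PAMinus (b : Bool) : (arith b).Sentence → Prop
  | add_assoc : PAMinus b
      (∀' ∀' ∀' (((bv 0 + bv 1) + bv 2 : Tm b 3) =' (bv 0 + (bv 1 + bv 2))))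
  | add_comm : PAMinus b (∀' ∀' ((bv 0 + bv 1 : Tm b 2) =' (bv 1 + bv 0)))
  | mul_assoc : PAMinus b
      (∀' ∀' ∀' (((bv 0 * bv 1) * bv 2 : Tm b 3) =' (bv 0 * (bv 1 * bv 2))))
  | mul_comm : PAMinus b (∀' ∀' ((bv 0 * bv 1 : Tm b 2) =' (bv 1 * bv 0)))
  | mul_add : PAMinus b
      (∀' ∀' ∀' ((bv 0 * (bv 1 + bv 2) : Tm b 3) =' (bv 0 * bv 1 + bv 0 * bv 2)))
  | add_zero : PAMinus b (∀' ((bv 0 + 0 : Tm b 1) =' bv 0))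
  | mul_zero : PAMinus b (∀' ((bv 0 * 0 : Tm b 1) =' 0))
  | mul_one : PAMinus b (∀' ((bv 0 * 1 : Tm b 1) =' bv 0))
  | lt_irrefl : PAMinus b (∀' ∼ (ltF (bv 0 : Tm b 1) (bv 0)))
  | lt_trans : PAMinus b
      (∀' ∀' ∀' (ltF (bv 0 : Tm b 3) (bv 1) ⟹ ltF (bv 1) (bv 2) ⟹ ltF (bv 0) (bv 2)))
  | lt_total : PAMinus b
      (∀' ∀' (ltF (bv 0 : Tm b 2) (bv 1) ⊔ ((bv 0 =' bv 1) ⊔ ltF (bv 1) (bv 0))))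
  | add_lt_add : PAMinus b
      (∀' ∀' ∀' (ltF (bv 0 : Tm b 3) (bv 1) ⟹ ltF (bv 0 + bv 2) (bv 1 + bv 2)))
  | mul_lt_mul : PAMinus b
      (∀' ∀' ∀' (ltF 0 (bv 2 : Tm b 3) ⟹ ltF (bv 0) (bv 1) ⟹ ltF (bv 0 * bv 2) (bv 1 * bv 2)))
  | sub : PAMinus b
      (∀' ∀' (ltF (bv 0 : Tm b 2) (bv 1) ⟹ ∃' ((bv 0 + bv 2 : Tm b 3) =' bv 1)))
  | nonneg : PAMinus b (∀' ∼ (ltF (bv 0 : Tm b 1) 0))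
  | zero_lt_one : PAMinus b (ltF (0 : Tm b 0) 1)
  | discrete : PAMinus b (∀' (ltF 0 (bv 0 : Tm b 1) ⟹ ∼ (ltF (bv 0) 1)))

/-- The induction axiom for `φ` in its last variable `x`, the other variables being parameters:
the universal closure of `φ(0) ∧ ∀ x (φ(x) → φ(x + 1)) → ∀ x φ(x)`. -/
def inductionAx {b : Bool} {n : ℕ} (φ : Fm b (n + 1)) : (arith b).Sentence :=
  BoundedFormula.alls
    ((inst φ (Fin.snoc (α := fun _ => Tm b n) bv 0) ⊓
      ∀' (φ ⟹ inst φ (Fin.snoc (α := fun _ => Tm b (n + 1))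
        (fun i => bv i.castSucc) (lastV + 1)))) ⟹ ∀' φ)

/-- `IΔ₀` in the language `arith b`. -/
def IDelta0 (b : Bool) : (arith b).Theory :=
  {σ | PAMinus b σ ∨ ∃ (n : ℕ) (φ : Fm b (n + 1)), IsDelta0 φ ∧ σ = inductionAx φ}

/-! ### The graph of `x ↦ x ^ len x` as a bounded formula

The computation of `y = a ^ k` by repeated squaring is a chain of pairs `(0, 1), …, (k, y)` in
which `(i, e)` is followed by `(2 i, e²)` or by `(2 i + 1, e² a)`. Such a chain is coded by numbers
`U, K, E`: its entries sit at certain powers of two `u`, in the block of binary digits that starts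
at `u` and ends before `u²`; that block of `U` is `1` exactly at the positions in use, and the
blocks of `K` and `E` there are the two components of the entry. The positions `2^(w·2^i)` with
`2 ^ w > a` give a code below a fixed power of `a + y + 2` when `a ≥ 2`. -/

section Graph

variable {b : Bool} {n : ℕ}

/-- `u` is a power of two (or `0`): each of its divisors is `1` or even. -/
def pow2F (u : Tm b n) : Fm b n :=
  ballF (u + 1) <| -- d
    bexF (up u + 1) ((up (up u)) =' (up lastV * lastV)) ⟹
      ((lastV =' 1) ⊔ bexF (lastV + 1) ((up lastV) =' (lastV + lastV)))

/-- `e = ⌊z / u⌋ mod u`, that is, `e < u` and `z = (q u + e) u + r` with some `r < u`. -/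
def digitF (z u e : Tm b n) : Fm b n :=
  ltF e u ⊓
    (bexF (z + 1) <| -- q
      bexF (up u) <| -- r
        (up (up z)) =' ((up lastV * up (up u) + up (up e)) * up (up u) + lastV))

/-- The pair `(k, e)` is the entry at position `u` of the chain coded by `U, K, E`. -/
def entryF (U K E u k e : Tm b n) : Fm b n :=
  pow2F u ⊓ (digitF U u 1 ⊓ (digitF K u k ⊓ digitF E u e))

/-- Each entry `(k, e)` of the chain coded by `U, K, E` (all below `B`) is `(0, 1)` or
arises from an earlier entry `(k', e')` as `(2 k', e'²)` or `(2 k' + 1, e'² a)`. -/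
def chainF (B a U K E : Tm b n) : Fm b n :=
  ballF B <| ballF (up B) <| ballF (up (up B)) <| -- u, k, e
    let u : Tm b (n + 3) := up (up lastV)
    let k : Tm b (n + 3) := up lastV
    let e : Tm b (n + 3) := lastV
    let l : Tm b n → Tm b (n + 3) := fun t => up (up (up t))
    entryF (l U) (l K) (l E) u k e ⟹
      (((k =' 0) ⊓ (e =' 1)) ⊔
        (bexF u <| bexF (up (l B)) <| bexF (up (up (l B))) <| -- u', k', e'
          let u' : Tm b (n + 6) := up (up lastV)
          let k' : Tm b (n + 6) := up lastV
          let e' : Tm b (n + 6) := lastV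
          let m : Tm b (n + 3) → Tm b (n + 6) := fun t => up (up (up t))
          entryF (m (l U)) (m (l K)) (m (l E)) u' k' e' ⊓
            (((m k =' (k' + k')) ⊓ (m e =' (e' * e'))) ⊔
              ((m k =' (k' + k' + 1)) ⊓ (m e =' (e' * e' * m (l a)))))))

/-- `y = a ^ k`, as witnessed by a code below `B`. -/
def powF (B a k y : Tm b n) : Fm b n :=
  bexF B <| bexF (up B) <| bexF (up (up B)) <| -- U, K, E
    let U : Tm b (n + 3) := up (up lastV)
    let K : Tm b (n + 3) := up lastV
    let E : Tm b (n + 3) := lastV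
    let l : Tm b n → Tm b (n + 3) := fun t => up (up (up t))
    chainF (l B) (l a) U K E ⊓
      bexF (l B) (entryF (up U) (up K) (up E) lastV (up (l k)) (up (l y)))

/-- `t ^ 8`. -/
def pow8 (t : Tm b n) : Tm b n := ((t * t) * (t * t)) * ((t * t) * (t * t))

/-- `y = x ^ len x`: there are `k ≤ x` and `p = 2 ^ k` with `x < p ≤ 2 x + 1`
(so that `k` is the bit length of `x`, which is `0` for `x = 0`), and `y = x ^ k`. -/
def omegaF (x y : Tm b n) : Fm b n :=
  bexF (x + 1) <| bexF (up (x + x + 1 + 1)) <| -- k, p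
    let k : Tm b (n + 2) := up lastV
    let p : Tm b (n + 2) := lastV
    let x' : Tm b (n + 2) := up (up x)
    let y' : Tm b (n + 2) := up (up y)
    let B : Tm b (n + 2) := pow8 (x' + y' + 1 + 1)
    ltF x' p ⊓ (powF B (1 + 1) k p ⊓ powF B x' k y')

end Graph

/-- `Ω₁`: for every `x` the number `x ^ len x` exists. -/
def Omega1 : (arith false).Sentence := ∀' ∃' (omegaF (bv 0 : Tm false 2) (bv 1))

/-- `om` is the function `x ↦ x ^ len x`. -/
def omegaAx : (arith true).Sentence := ∀' (omegaF (bv 0 : Tm true 1) (omT (bv 0)))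

/-- `IΔ₀ + Ω₁` in the language `{0, 1, +, ·, <}`. -/
def IDelta0Omega1 : (arith false).Theory := IDelta0 false ∪ {Omega1}

/-- `IΔ₀ + Ω₁` with a function symbol for `x ↦ x ^ len x`, which may occur in the formulas of the
induction scheme and in the bounds of their quantifiers. -/
def IDelta0Omega1Fun : (arith true).Theory := IDelta0 true ∪ {omegaAx}

/-! ## The theory of numbers, functions and operators

A three-sorted language: variables of each sort are named by natural numbers. -/

/-- Function terms: `f` and `F(g)`. -/
inductive FTerm : Type
  | var (i : ℕ) : FTerm
  | op (F : ℕ) (g : FTerm) : FTerm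

/-- Number terms; `ap g t` is the value `g(t)`. -/
inductive NTerm : Type
  | var (i : ℕ) : NTerm
  | zero : NTerm
  | one : NTerm
  | add (t s : NTerm) : NTerm
  | mul (t s : NTerm) : NTerm
  | om (t : NTerm) : NTerm
  | ap (g : FTerm) (t : NTerm) : NTerm

/-- Formulas, with quantifiers over numbers, functions and operators. Equality is primitive only
for numbers. -/
inductive Fml : Type
  | falsum : Fml
  | eq (t s : NTerm) : Fml
  | lt (t s : NTerm) : Fml
  | imp (φ ψ : Fml) : Fml
  | allN (x : ℕ) (φ : Fml) : Fml
  | allF (f : ℕ) (φ : Fml) : Fml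
  | allO (F : ℕ) (φ : Fml) : Fml

namespace Fml

def neg (φ : Fml) : Fml := imp φ falsum
def and (φ ψ : Fml) : Fml := neg (imp φ (neg ψ))
def exN (x : ℕ) (φ : Fml) : Fml := neg (allN x (neg φ))
def exF (f : ℕ) (φ : Fml) : Fml := neg (allF f (neg φ))
def exO (F : ℕ) (φ : Fml) : Fml := neg (allO F (neg φ))

end Fml

/-! Occurrence of variables in terms and free occurrence in formulas. -/

def FTerm.UsesF (f : ℕ) : FTerm → Prop
  | .var i => i = f
  | .op _ g => g.UsesF f

def FTerm.UsesO (F : ℕ) : FTerm → Prop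
  | .var _ => False
  | .op G g => G = F ∨ g.UsesO F

def NTerm.UsesN (x : ℕ) : NTerm → Prop
  | .var i => i = x
  | .zero => False
  | .one => False
  | .add t s => t.UsesN x ∨ s.UsesN x
  | .mul t s => t.UsesN x ∨ s.UsesN x
  | .om t => t.UsesN x
  | .ap _ t => t.UsesN x

def NTerm.UsesF (f : ℕ) : NTerm → Prop
  | .var _ => False
  | .zero => False
  | .one => False
  | .add t s => t.UsesF f ∨ s.UsesF f
  | .mul t s => t.UsesF f ∨ s.UsesF f
  | .om t => t.UsesF f
  | .ap g t => g.UsesF f ∨ t.UsesF f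

def NTerm.UsesO (F : ℕ) : NTerm → Prop
  | .var _ => False
  | .zero => False
  | .one => False
  | .add t s => t.UsesO F ∨ s.UsesO F
  | .mul t s => t.UsesO F ∨ s.UsesO F
  | .om t => t.UsesO F
  | .ap g t => g.UsesO F ∨ t.UsesO F

def Fml.UsesN (x : ℕ) : Fml → Prop
  | .falsum => False
  | .eq t s => t.UsesN x ∨ s.UsesN x
  | .lt t s => t.UsesN x ∨ s.UsesN x
  | .imp φ ψ => φ.UsesN x ∨ ψ.UsesN x
  | .allN y φ => y ≠ x ∧ φ.UsesN x
  | .allF _ φ => φ.UsesN x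
  | .allO _ φ => φ.UsesN x

def Fml.UsesF (f : ℕ) : Fml → Prop
  | .falsum => False
  | .eq t s => t.UsesF f ∨ s.UsesF f
  | .lt t s => t.UsesF f ∨ s.UsesF f
  | .imp φ ψ => φ.UsesF f ∨ ψ.UsesF f
  | .allN _ φ => φ.UsesF f
  | .allF g φ => g ≠ f ∧ φ.UsesF f
  | .allO _ φ => φ.UsesF f

def Fml.UsesO (F : ℕ) : Fml → Prop
  | .falsum => False
  | .eq t s => t.UsesO F ∨ s.UsesO F
  | .lt t s => t.UsesO F ∨ s.UsesO F
  | .imp φ ψ => φ.UsesO F ∨ ψ.UsesO F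
  | .allN _ φ => φ.UsesO F
  | .allF _ φ => φ.UsesO F
  | .allO G φ => G ≠ F ∧ φ.UsesO F

/-! ### Comprehension and bounded formulas -/

/-- `r = μ(m < T : φ(m))`, the least `m < T` with `φ(m)`, or `T` if there is none: `r ≤ T`, no
`m < r` has `φ(m)`, and if `r < T` then `φ(r)`. Used where `m` does not occur in `r` or `T`. -/
def muF (r : NTerm) (m : ℕ) (T : NTerm) (φ : Fml) : Fml :=
  Fml.and (Fml.neg (.lt T r))
    (Fml.and (.allN m (.imp (.lt (.var m) r) (Fml.neg φ)))
      (.imp (.lt r T) (.allN m (.imp (.eq (.var m) r) φ))))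

/-- `∀ n, f(n) = μ(m < T(n) : φ(m, n))`. -/
def defF (f n m : ℕ) (T : NTerm) (φ : Fml) : Fml :=
  .allN n (muF (.ap (.var f) (.var n)) m T φ)

/-- `∀ f ∀ n, F(f)(n) = μ(m < T(n) : φ(m, n, f))`; the term `T` may also contain `f`. -/
def defO (F f n m : ℕ) (T : NTerm) (φ : Fml) : Fml :=
  .allF f (.allN n (muF (.ap (.op F (.var f)) (.var n)) m T φ))

/-- The variable conditions for the definition of `f` by `T` and `φ`. -/
def OkF (f n m : ℕ) (T : NTerm) (φ : Fml) : Prop :=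
  n ≠ m ∧ ¬ T.UsesN m ∧ ¬ T.UsesF f ∧ ¬ φ.UsesF f

/-- The variable conditions for the definition of `F` by `T` and `φ`. -/
def OkO (F n m : ℕ) (T : NTerm) (φ : Fml) : Prop :=
  n ≠ m ∧ ¬ T.UsesN m ∧ ¬ T.UsesO F ∧ ¬ φ.UsesO F

/-- Bounded quantifier formulas: number quantifiers are bounded by terms, and function and operator
quantifiers range only over the object given by an explicit bounded minimization. -/
inductive IsBdd : Fml → Prop
  | falsum : IsBdd .falsum
  | eq (t s : NTerm) : IsBdd (.eq t s)
  | lt (t s : NTerm) : IsBdd (.lt t s)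
  | imp {φ ψ : Fml} : IsBdd φ → IsBdd ψ → IsBdd (.imp φ ψ)
  | allN (z : ℕ) (S : NTerm) {φ : Fml} : ¬ S.UsesN z → IsBdd φ →
      IsBdd (.allN z (.imp (.lt (.var z) S) φ))
  | exN (z : ℕ) (S : NTerm) {φ : Fml} : ¬ S.UsesN z → IsBdd φ →
      IsBdd (Fml.exN z (Fml.and (.lt (.var z) S) φ))
  | allF (f n m : ℕ) (T : NTerm) {φ ψ : Fml} : OkF f n m T φ → IsBdd φ → IsBdd ψ →
      IsBdd (.allF f (.imp (defF f n m T φ) ψ))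
  | exF (f n m : ℕ) (T : NTerm) {φ ψ : Fml} : OkF f n m T φ → IsBdd φ → IsBdd ψ →
      IsBdd (Fml.exF f (Fml.and (defF f n m T φ) ψ))
  | allO (F f n m : ℕ) (T : NTerm) {φ ψ : Fml} : OkO F n m T φ → IsBdd φ → IsBdd ψ →
      IsBdd (.allO F (.imp (defO F f n m T φ) ψ))
  | exO (F f n m : ℕ) (T : NTerm) {φ ψ : Fml} : OkO F n m T φ → IsBdd φ → IsBdd ψ →
      IsBdd (Fml.exO F (Fml.and (defO F f n m T φ) ψ))

/-! ### First-order formulas as formulas about the sort of numbers -/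

def ofFunc {b : Bool} {k : ℕ} (c : ArithFunc b k) (ts : Fin k → NTerm) : NTerm :=
  match c, ts with
  | .zero, _ => .zero
  | .one, _ => .one
  | .add, ts => .add (ts 0) (ts 1)
  | .mul, ts => .mul (ts 0) (ts 1)
  | .om, ts => .om (ts 0)

def ofTerm {b : Bool} {n : ℕ} : Tm b n → NTerm
  | .var (.inl e) => e.elim
  | .var (.inr i) => .var i
  | .func c ts => ofFunc c fun i => ofTerm (ts i)

def ofRel {k : ℕ} (R : ArithRel k) (ts : Fin k → NTerm) : Fml :=
  match R, ts with
  | .lt, ts => .lt (ts 0) (ts 1)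

/-- The variable `&i` becomes the number variable `i`. -/
def ofFm {b : Bool} : ∀ {n : ℕ}, Fm b n → Fml
  | _, .falsum => .falsum
  | _, .equal t s => .eq (ofTerm t) (ofTerm s)
  | _, .rel R ts => ofRel R fun i => ofTerm (ts i)
  | _, .imp φ ψ => .imp (ofFm φ) (ofFm ψ)
  | n, .all φ => .allN n (ofFm φ)

/-! ### The axioms -/

/-- The axioms of the theory of numbers, functions and operators. Axioms may have free variables,
which are understood as universally quantified. -/
inductive HOAxiom : Fml → Prop
  /-- Basic arithmetical axioms. -/
  | basic (σ : (arith true).Sentence) : PAMinus true σ → HOAxiom (ofFm σ)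
  | omega : HOAxiom (ofFm omegaAx)
  /-- Induction: `φ(0) ∧ ∀ k (φ(k) → φ(k + 1)) → ∀ x φ(x)`, where `φ(t)` is written as
  `∀ x (x = t → φ(x))`. -/
  | induction (x k : ℕ) (φ : Fml) : IsBdd φ → x ≠ k → ¬ φ.UsesN k →
      HOAxiom (.imp
        (Fml.and (.allN x (.imp (.eq (.var x) .zero) φ))
          (.allN k (.imp (.allN x (.imp (.eq (.var x) (.var k)) φ))
            (.allN x (.imp (.eq (.var x) (.add (.var k) .one)) φ)))))
        (.allN x φ))
  /-- Extensionality: `∀ n f(n) = g(n) → ∀ m F(f)(m) = F(g)(m)`. -/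
  | ext (F f g n m : ℕ) : HOAxiom (.imp
      (.allN n (.eq (.ap (.var f) (.var n)) (.ap (.var g) (.var n))))
      (.allN m (.eq (.ap (.op F (.var f)) (.var m)) (.ap (.op F (.var g)) (.var m)))))
  /-- Bounded quantifier comprehension for functions. -/
  | compF (f n m : ℕ) (T : NTerm) (φ : Fml) : IsBdd φ → OkF f n m T φ →
      HOAxiom (Fml.exF f (defF f n m T φ))
  /-- Bounded quantifier comprehension for operators. -/
  | compO (F f n m : ℕ) (T : NTerm) (φ : Fml) : IsBdd φ → OkO F n m T φ →
      HOAxiom (Fml.exO F (defO F f n m T φ))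

/-! ### Semantics of the three-sorted language -/

/-- A three-sorted structure with nonempty sorts. -/
structure HOStructure : Type 1 where
  /-- numbers -/
  N : Type
  /-- functions -/
  Fn : Type
  /-- operators -/
  Op : Type
  zero : N
  one : N
  add : N → N → N
  mul : N → N → N
  om : N → N
  lt : N → N → Prop
  ap : Fn → N → N
  op : Op → Fn → Fn
  nonempty_Fn : Nonempty Fn
  nonempty_Op : Nonempty Op

namespace HOStructure

def evalF (M : HOStructure) (vf : ℕ → M.Fn) (vo : ℕ → M.Op) : FTerm → M.Fn
  | .var i => vf i
  | .op F g => M.op (vo F) (M.evalF vf vo g)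

def evalN (M : HOStructure) (vn : ℕ → M.N) (vf : ℕ → M.Fn)
    (vo : ℕ → M.Op) : NTerm → M.N
  | .var i => vn i
  | .zero => M.zero
  | .one => M.one
  | .add t s => M.add (M.evalN vn vf vo t) (M.evalN vn vf vo s)
  | .mul t s => M.mul (M.evalN vn vf vo t) (M.evalN vn vf vo s)
  | .om t => M.om (M.evalN vn vf vo t)
  | .ap g t => M.ap (M.evalF vf vo g) (M.evalN vn vf vo t)

/-- Satisfaction under an assignment of values to the variables of the three sorts. -/
def Sat (M : HOStructure) (vn : ℕ → M.N) (vf : ℕ → M.Fn) (vo : ℕ → M.Op) : Fml → Prop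
  | .falsum => False
  | .eq t s => M.evalN vn vf vo t = M.evalN vn vf vo s
  | .lt t s => M.lt (M.evalN vn vf vo t) (M.evalN vn vf vo s)
  | .imp φ ψ => M.Sat vn vf vo φ → M.Sat vn vf vo ψ
  | .allN x φ => ∀ a : M.N, M.Sat (Function.update vn x a) vf vo φ
  | .allF f φ => ∀ g : M.Fn, M.Sat vn (Function.update vf f g) vo φ
  | .allO F φ => ∀ G : M.Op, M.Sat vn vf (Function.update vo F G) φ

/-- The universal closure of `φ` is true in `M`. -/
def Models (M : HOStructure) (φ : Fml) : Prop :=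
  ∀ (vn : ℕ → M.N) (vf : ℕ → M.Fn) (vo : ℕ → M.Op), M.Sat vn vf vo φ

end HOStructure

/-- `φ` is a theorem of the theory of numbers, functions and operators: it is a logical consequence
of the axioms. -/
def HOTheorem (φ : Fml) : Prop :=
  ∀ M : HOStructure, (∀ ψ, HOAxiom ψ → M.Models ψ) → M.Models φ

end LimitedExp

/-! Provability means truth in all models, so conservativity comes from two constructions on models.
In one direction, the numbers of a model of `T` satisfy the arithmetic: a translated Δ₀ formula is a
bounded quantifier formula, so its induction axiom belongs to `T`, and `om x` witnesses Ω₁.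

In the other direction, every model `N` of the arithmetic is made the number sort of a model of `T`.
If the symbol `om` is missing, Ω₁ supplies the values. Codes of repeated squaring can be compared by
Δ₀ induction (`Chain.compare`), so the graph formula is single-valued and monotone (`OmegaRel.le`).
Hence induction extends to formulas containing `om` (`HasInd.expand`): below a given number such a
formula agrees with one in which `om` is cut off at a large parameter, and that one is Δ₀.

The functions of the new model are all maps on `N` that are bounded by a term and have a bounded
graph (`IsGood`). The operators are the maps that send uniformly defined families of such functions
to uniformly defined families. A restricted function or operator quantifier ranges over exactly one
object (`Good.sat_defF`, `Good.sat_defO`), so it amounts to substituting a defined object. Therefore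
every bounded quantifier formula defines a bounded predicate, uniformly in its parameters
(`Good.uniform_of_isBdd`). Induction is then inherited from `N`, comprehension follows because
bounded minimization of a bounded predicate is good (`HasInd.isGood_mu`), and extensionality holds
because functions are genuine maps. -/

namespace LimitedExp

/-! ### Arithmetical operations and structures -/

/-- The operations of arithmetic on a set `N`. -/
structure ArithOps (N : Type) where
  zero : N
  one : N
  add : N → N → N
  mul : N → N → N
  om : N → N
  lt : N → N → Prop

namespace ArithOps

variable {N : Type}

/-- The value of a function symbol. -/
def func (A : ArithOps N) {b : Bool} : ∀ {k : ℕ}, ArithFunc b k → (Fin k → N) → N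
  | _, .zero, _ => A.zero
  | _, .one, _ => A.one
  | _, .add, xs => A.add (xs 0) (xs 1)
  | _, .mul, xs => A.mul (xs 0) (xs 1)
  | _, .om, xs => A.om (xs 0)

/-- The meaning of the relation symbol. -/
def rel (A : ArithOps N) : ∀ {k : ℕ}, ArithRel k → (Fin k → N) → Prop
  | _, .lt, xs => A.lt (xs 0) (xs 1)

/-- The first-order structure given by the operations. -/
abbrev str (A : ArithOps N) (b : Bool) : (arith b).Structure N where
  funMap c xs := A.func c xs
  RelMap R xs := A.rel R xs

/-- A given structure has the operations `A`. -/
structure Interprets (A : ArithOps N) (b : Bool) [(arith b).Structure N] : Prop where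
  func : ∀ {k : ℕ} (c : ArithFunc b k) (xs : Fin k → N),
    Structure.funMap (L := arith b) c xs = A.func c xs
  rel : ∀ {k : ℕ} (R : ArithRel k) (xs : Fin k → N),
    Structure.RelMap (L := arith b) R xs ↔ A.rel R xs

theorem interprets_str (A : ArithOps N) (b : Bool) :
    letI := A.str b
    A.Interprets b :=
  letI := A.str b
  ⟨fun _ _ => rfl, fun _ _ => Iff.rfl⟩

/-- The operations of a structure; `om` is arbitrary if the language does not contain it. -/
def ofStr (b : Bool) (N : Type) [S : (arith b).Structure N] (g : N → N) : ArithOps N where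
  zero := Structure.funMap (L := arith b) ArithFunc.zero ![]
  one := Structure.funMap (L := arith b) ArithFunc.one ![]
  add x y := Structure.funMap (L := arith b) ArithFunc.add ![x, y]
  mul x y := Structure.funMap (L := arith b) ArithFunc.mul ![x, y]
  om x := match b, S with
    | true, S => @Structure.funMap (arith true) N S _ ArithFunc.om ![x]
    | false, _ => g x
  lt x y := Structure.RelMap (L := arith b) ArithRel.lt ![x, y]

theorem interprets_ofStr (b : Bool) (N : Type) [(arith b).Structure N] (g : N → N) :
    (ofStr b N g).Interprets b := by
  have h1 : ∀ xs : Fin 1 → N, xs = ![xs 0] := fun xs => by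
    ext i; fin_cases i; rfl
  have h2 : ∀ xs : Fin 2 → N, xs = ![xs 0, xs 1] := fun xs => by
    ext i; fin_cases i <;> rfl
  constructor
  · intro k c xs
    cases c with
    | zero => exact congrArg _ (Subsingleton.elim _ _)
    | one => exact congrArg _ (Subsingleton.elim _ _)
    | add => exact congrArg _ (h2 xs)
    | mul => exact congrArg _ (h2 xs)
    | om => exact congrArg _ (h1 xs)
  · intro k R xs
    cases R with
    | lt => exact iff_of_eq (congrArg _ (h2 xs))

section Realize

variable {A : ArithOps N} {b : Bool} [(arith b).Structure N] (h : A.Interprets b) {n : ℕ}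
  {v : Empty ⊕ Fin n → N}
include h

theorem Interprets.zero : (0 : Tm b n).realize v = A.zero :=
  h.func ArithFunc.zero _

theorem Interprets.one : (1 : Tm b n).realize v = A.one :=
  h.func ArithFunc.one _

theorem Interprets.add (t s : Tm b n) : (t + s).realize v = A.add (t.realize v) (s.realize v) :=
  h.func ArithFunc.add _

theorem Interprets.mul (t s : Tm b n) : (t * s).realize v = A.mul (t.realize v) (s.realize v) :=
  h.func ArithFunc.mul _

theorem Interprets.ltF {w : Empty → N} {xs : Fin n → N} (t s : Tm b n) :
    (ltF t s).Realize w xs ↔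
      A.lt (t.realize (Sum.elim w xs)) (s.realize (Sum.elim w xs)) :=
  h.rel ArithRel.lt _

end Realize

theorem Interprets.omT {A : ArithOps N} [(arith true).Structure N] (h : A.Interprets true) {n : ℕ}
    {v : Empty ⊕ Fin n → N} (t : Tm true n) : (omT t).realize v = A.om (t.realize v) :=
  h.func ArithFunc.om _

end ArithOps

/-! ### Satisfaction of terms, substitutions and bounded quantifiers. -/

section Realize

variable {N : Type} {b : Bool} [(arith b).Structure N] {n : ℕ} {w : Empty → N}

theorem realize_bv (xs : Fin n → N) (i : Fin n) :
    (bv i : Tm b n).realize (Sum.elim w xs) = xs i := rfl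

theorem realize_lastV (xs : Fin n → N) (a : N) :
    (lastV : Tm b (n + 1)).realize (Sum.elim w (Fin.snoc xs a)) = a := by
  simp [lastV, realize_bv]

theorem realize_up (t : Tm b n) (xs : Fin n → N) (a : N) :
    (up t).realize (Sum.elim w (Fin.snoc xs a : Fin (n + 1) → N)) =
      t.realize (Sum.elim w xs) := by
  rw [up, Term.realize_relabel]
  congr 1
  funext i
  rcases i with i | i
  · rfl
  · simp

theorem realize_inst {m : ℕ} (φ : Fm b n) (s : Fin n → Tm b m) (xs : Fin m → N) :
    (inst φ s).Realize w xs ↔ φ.Realize w fun i => (s i).realize (Sum.elim w xs) := by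
  unfold inst
  rw [BoundedFormula.realize_relabel, BoundedFormula.realize_subst]
  have e : (xs ∘ Fin.natAdd m : Fin 0 → N) = default := Subsingleton.elim _ _
  rw [e]
  refine (BoundedFormula.realize_toFormula φ _).trans ?_
  refine iff_of_eq (congrArg₂ _ (Subsingleton.elim _ _) ?_)
  rfl

end Realize

section Realize

variable {N : Type} {A : ArithOps N} {b : Bool} [(arith b).Structure N] (h : A.Interprets b)
  {n : ℕ} {w : Empty → N} {xs : Fin n → N}
include h

theorem ArithOps.Interprets.ballF (t : Tm b n) (φ : Fm b (n + 1)) :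
    (ballF t φ).Realize w xs ↔
      ∀ z, A.lt z (t.realize (Sum.elim w xs)) → φ.Realize w (Fin.snoc xs z : Fin (n + 1) → N) := by
  simp only [LimitedExp.ballF, BoundedFormula.realize_all, BoundedFormula.realize_imp, h.ltF,
    realize_lastV, realize_up]

theorem ArithOps.Interprets.bexF (t : Tm b n) (φ : Fm b (n + 1)) :
    (bexF t φ).Realize w xs ↔
      ∃ z, A.lt z (t.realize (Sum.elim w xs)) ∧ φ.Realize w (Fin.snoc xs z : Fin (n + 1) → N) := by
  simp only [LimitedExp.bexF, BoundedFormula.realize_ex, BoundedFormula.realize_inf, h.ltF,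
    realize_lastV, realize_up]

end Realize

/-- The axioms of `PA⁻` as properties of the operations. -/
structure ArithOps.IsPA {N : Type} (A : ArithOps N) : Prop where
  add_assoc : ∀ x y z, A.add (A.add x y) z = A.add x (A.add y z)
  add_comm : ∀ x y, A.add x y = A.add y x
  mul_assoc : ∀ x y z, A.mul (A.mul x y) z = A.mul x (A.mul y z)
  mul_comm : ∀ x y, A.mul x y = A.mul y x
  mul_add : ∀ x y z, A.mul x (A.add y z) = A.add (A.mul x y) (A.mul x z)
  add_zero : ∀ x, A.add x A.zero = x
  mul_zero : ∀ x, A.mul x A.zero = A.zero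
  mul_one : ∀ x, A.mul x A.one = x
  lt_irrefl : ∀ x, ¬ A.lt x x
  lt_trans : ∀ x y z, A.lt x y → A.lt y z → A.lt x z
  lt_total : ∀ x y, A.lt x y ∨ x = y ∨ A.lt y x
  add_lt_add : ∀ x y z, A.lt x y → A.lt (A.add x z) (A.add y z)
  mul_lt_mul : ∀ x y z, A.lt A.zero z → A.lt x y → A.lt (A.mul x z) (A.mul y z)
  sub : ∀ x y, A.lt x y → ∃ z, A.add x z = y
  nonneg : ∀ x, ¬ A.lt x A.zero
  zero_lt_one : A.lt A.zero A.one
  discrete : ∀ x, A.lt A.zero x → ¬ A.lt x A.one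

theorem ArithOps.Interprets.paMinus_iff {N : Type} {A : ArithOps N} {b : Bool}
    [(arith b).Structure N] (h : A.Interprets b) :
    (∀ σ, PAMinus b σ → N ⊨ σ) ↔ A.IsPA := by
  constructor
  · intro H
    have H' : ∀ σ, PAMinus b σ → BoundedFormula.Realize σ (default : Empty → N) default := H
    have add_assoc := H' _ .add_assoc
    have add_comm := H' _ .add_comm
    have mul_assoc := H' _ .mul_assoc
    have mul_comm := H' _ .mul_comm
    have mul_add := H' _ .mul_add
    have add_zero := H' _ .add_zero
    have mul_zero := H' _ .mul_zero
    have mul_one := H' _ .mul_one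
    have lt_irrefl := H' _ .lt_irrefl
    have lt_trans := H' _ .lt_trans
    have lt_total := H' _ .lt_total
    have add_lt_add := H' _ .add_lt_add
    have mul_lt_mul := H' _ .mul_lt_mul
    have sub := H' _ .sub
    have nonneg := H' _ .nonneg
    have zero_lt_one := H' _ .zero_lt_one
    have discrete := H' _ .discrete
    simp only [h.zero, h.one, h.add, h.mul, h.ltF, realize_bv,
      BoundedFormula.realize_all, BoundedFormula.realize_ex, BoundedFormula.realize_imp,
      BoundedFormula.realize_not,
      BoundedFormula.realize_sup, BoundedFormula.realize_bdEqual]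
      at add_assoc add_comm mul_assoc mul_comm mul_add add_zero mul_zero
        mul_one lt_irrefl lt_trans lt_total
        add_lt_add mul_lt_mul sub nonneg zero_lt_one discrete
    exact ⟨add_assoc, add_comm, mul_assoc, mul_comm, mul_add, add_zero, mul_zero, mul_one,
      lt_irrefl, lt_trans, lt_total, add_lt_add, mul_lt_mul, sub, nonneg, zero_lt_one, discrete⟩
  · intro H σ hσ
    change BoundedFormula.Realize σ default default
    cases hσ <;> simp only [h.zero, h.one, h.add, h.mul, h.ltF, realize_bv,
      BoundedFormula.realize_all, BoundedFormula.realize_ex, BoundedFormula.realize_imp,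
      BoundedFormula.realize_not,
      BoundedFormula.realize_sup, BoundedFormula.realize_bdEqual]
    · exact H.add_assoc
    · exact H.add_comm
    · exact H.mul_assoc
    · exact H.mul_comm
    · exact H.mul_add
    · exact H.add_zero
    · exact H.mul_zero
    · exact H.mul_one
    · exact H.lt_irrefl
    · exact H.lt_trans
    · exact H.lt_total
    · exact H.add_lt_add
    · exact H.mul_lt_mul
    · exact H.sub
    · exact H.nonneg
    · exact H.zero_lt_one
    · exact H.discrete

/-! ### Models of `PA⁻` as ordered semirings -/

/-- Nonnegative parts of discretely ordered commutative rings. -/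
class DiscreteSemiring (N : Type) extends CommSemiring N, LinearOrder N, IsStrictOrderedRing N,
    CanonicallyOrderedAdd N where
  lt_add_one_iff' : ∀ a b : N, a < b + 1 ↔ a ≤ b

/-- The operations of a discretely ordered semiring, together with a unary function. -/
def semiringOps (N : Type) [DiscreteSemiring N] (om : N → N) : ArithOps N where
  zero := 0
  one := 1
  add := (· + ·)
  mul := (· * ·)
  om := om
  lt := (· < ·)

section

variable {N : Type}

open Classical in
/-- The ordered semiring given by a model of `PA⁻`. -/
@[reducible] noncomputable def discreteSemiringOfIsPA {A : ArithOps N} (h : A.IsPA) :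
    DiscreteSemiring N :=
  let Z : Zero N := ⟨A.zero⟩
  let P : Add N := ⟨A.add⟩
  let R : CommSemiring N :=
    { zero := A.zero
      one := A.one
      add := A.add
      mul := A.mul
      add_assoc := h.add_assoc
      zero_add := fun a => (h.add_comm _ _).trans (h.add_zero a)
      add_zero := h.add_zero
      add_comm := h.add_comm
      nsmul := nsmulRec
      left_distrib := h.mul_add
      right_distrib := fun a b c => by
        change A.mul (A.add a b) c = A.add (A.mul a c) (A.mul b c)
        rw [h.mul_comm, h.mul_add, h.mul_comm c, h.mul_comm c]
      zero_mul := fun a => (h.mul_comm _ _).trans (h.mul_zero a)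
      mul_zero := h.mul_zero
      mul_assoc := h.mul_assoc
      one_mul := fun a => (h.mul_comm _ _).trans (h.mul_one a)
      mul_one := h.mul_one
      mul_comm := h.mul_comm }
  -- `<` stays the relation of `A` and `≤` is defined from it, so the resulting operations are
  -- definitionally those of `A`.
  let O : LinearOrder N :=
    { le := fun a b => A.lt a b ∨ a = b
      lt := A.lt
      le_refl := fun a => Or.inr rfl
      le_trans := by
        rintro a b c (h1 | rfl) (h2 | rfl)
        · exact Or.inl (h.lt_trans _ _ _ h1 h2)
        · exact Or.inl h1
        · exact Or.inl h2
        · exact Or.inr rfl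
      lt_iff_le_not_ge := fun a b => by
        constructor
        · refine fun h1 => ⟨Or.inl h1, ?_⟩
          rintro (h2 | rfl)
          · exact h.lt_irrefl _ (h.lt_trans _ _ _ h1 h2)
          · exact h.lt_irrefl _ h1
        · rintro ⟨h1 | rfl, h2⟩
          · exact h1
          · exact (h2 (Or.inr rfl)).elim
      le_antisymm := by
        rintro a b (h1 | rfl) h2
        · rcases h2 with h2 | h2
          · exact (h.lt_irrefl _ (h.lt_trans _ _ _ h1 h2)).elim
          · exact h2.symm
        · rfl
      le_total := fun a b => by
        rcases h.lt_total a b with h1 | h1 | h1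
        · exact Or.inl (Or.inl h1)
        · exact Or.inl (Or.inr h1)
        · exact Or.inr (Or.inl h1)
      toDecidableLE := Classical.decRel _ }
  have add_lt : ∀ a b c : N, b < c → a + b < a + c := fun a b c hbc => by
    rw [add_comm a, add_comm a]
    exact h.add_lt_add _ _ _ hbc
  have add_le : ∀ a b c : N, b ≤ c → a + b ≤ a + c := fun a b c hbc =>
    hbc.elim (fun h1 => Or.inl (add_lt a b c h1)) fun h1 => Or.inr (h1 ▸ rfl)
  have nonneg : ∀ a : N, 0 ≤ a := fun a => not_lt.1 (h.nonneg a)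
  have sub : ∀ a b : N, a ≤ b → ∃ c, b = a + c := fun a b hab =>
    hab.elim (fun h1 => (h.sub a b h1).imp fun c hc => hc.symm)
      fun h1 => ⟨0, h1.symm.trans (add_zero a).symm⟩
  have self_add : ∀ a b : N, a ≤ a + b := fun a b => by
    simpa using add_le a 0 b (nonneg b)
  { R, O with
    add_le_add_left := fun a b hab c => by
      rw [add_comm a, add_comm b]
      exact add_le c a b hab
    le_of_add_le_add_left := fun a b c hab => by
      by_contra hlt
      exact absurd hab (not_le.2 (add_lt a c b (not_le.1 hlt)))
    zero_le_one := Or.inl h.zero_lt_one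
    exists_pair_ne := ⟨0, 1, fun h0 => by
      have h1 : A.lt A.zero A.one := h.zero_lt_one
      exact h.lt_irrefl A.one ((congrArg (fun x => A.lt x A.one) h0).mp h1)⟩
    mul_lt_mul_of_pos_left := fun a ha b c hbc => by
      rw [mul_comm a, mul_comm a]
      exact h.mul_lt_mul _ _ _ ha hbc
    mul_lt_mul_of_pos_right := fun a ha b c hbc => h.mul_lt_mul _ _ _ ha hbc
    exists_add_of_le := fun {a b} => sub a b
    le_add_self := fun a b => by
      rw [add_comm]
      exact self_add a b
    le_self_add := fun a b => self_add a b
    lt_add_one_iff' := fun a b => by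
      constructor
      · intro hab
        -- Otherwise `a = b + c` with `0 < c`, and discreteness gives `1 ≤ c`, hence `b + 1 ≤ a`.
        by_contra hlt
        obtain ⟨c, rfl⟩ := sub _ _ (not_le.1 hlt).le
        have hc : 0 < c := by
          rcases lt_or_eq_of_le (nonneg c) with h1 | h1
          · exact h1
          · subst h1
            simp at hlt
        have h1 : 1 ≤ c := not_lt.1 (h.discrete c hc)
        exact absurd hab (not_lt.2 (add_le b 1 c h1))
      · intro hab
        refine lt_of_le_of_lt hab ?_
        simpa using add_lt b 0 1 h.zero_lt_one }

theorem isPA_semiringOps [DiscreteSemiring N] (om : N → N) : (semiringOps N om).IsPA where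
  add_assoc := add_assoc
  add_comm := add_comm
  mul_assoc := mul_assoc
  mul_comm := mul_comm
  mul_add := mul_add
  add_zero := add_zero
  mul_zero := mul_zero
  mul_one := mul_one
  lt_irrefl := lt_irrefl
  lt_trans _ _ _ := lt_trans
  lt_total := lt_trichotomy
  add_lt_add _ _ z h := add_lt_add_left h z
  mul_lt_mul _ _ _ hz h := mul_lt_mul_of_pos_right h hz
  sub _ _ h := (exists_add_of_le h.le).imp fun _ hz => hz.symm
  nonneg x := not_lt.2 (zero_le (a := x))
  zero_lt_one := zero_lt_one (α := N)
  discrete x hx h1 := by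
    have h2 := (DiscreteSemiring.lt_add_one_iff' x 0).1 (lt_of_lt_of_eq h1 (zero_add 1).symm)
    exact absurd hx (not_lt.2 h2)

variable [DiscreteSemiring N]

theorem lt_succ_iff {a b : N} : a < b + 1 ↔ a ≤ b :=
  DiscreteSemiring.lt_add_one_iff' a b

theorem succ_le_iff' {a b : N} : a + 1 ≤ b ↔ a < b := by
  rw [← not_lt, lt_succ_iff, not_le]

/-! ### Bounded predicates on sequences -/

/-- The sequence `z, v 0, v 1, …`. -/
def cons (z : N) (v : ℕ → N) : ℕ → N
  | 0 => z
  | i + 1 => v i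

/-- The sequence `v 1, v 2, …`. -/
def tail (v : ℕ → N) : ℕ → N := fun i => v (i + 1)

/-- Polynomials with parameters in the variables `v 0, v 1, …`, which may also contain the unary
functions in `Ω`. -/
inductive IsTm (Ω : Set (N → N)) : ((ℕ → N) → N) → Prop
  | var (i : ℕ) : IsTm Ω fun v => v i
  | const (c : N) : IsTm Ω fun _ => c
  | add {f g} : IsTm Ω f → IsTm Ω g → IsTm Ω fun v => f v + g v
  | mul {f g} : IsTm Ω f → IsTm Ω g → IsTm Ω fun v => f v * g v
  | app {g f} : g ∈ Ω → IsTm Ω f → IsTm Ω fun v => g (f v)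

/-- Predicates defined by bounded formulas with parameters. -/
inductive IsDef (Ω : Set (N → N)) : ((ℕ → N) → Prop) → Prop
  | falsum : IsDef Ω fun _ => False
  | eq {f g} : IsTm Ω f → IsTm Ω g → IsDef Ω fun v => f v = g v
  | lt {f g} : IsTm Ω f → IsTm Ω g → IsDef Ω fun v => f v < g v
  | imp {P Q} : IsDef Ω P → IsDef Ω Q → IsDef Ω fun v => P v → Q v
  | ball' {f P} : IsTm Ω f → IsDef Ω P → IsDef Ω fun v => ∀ z < f v, P (cons z v)

/-- Induction for bounded predicates. -/
def HasInd (Ω : Set (N → N)) : Prop :=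
  ∀ P, IsDef Ω P → ∀ v : ℕ → N, P (cons 0 v) → (∀ z, P (cons z v) → P (cons (z + 1) v)) →
    ∀ z, P (cons z v)

namespace IsDef

variable {Ω : Set (N → N)} {P Q : (ℕ → N) → Prop}

/-- `tail (cons z v)` and `(cons z v) 0` compute to `v` and `z`, so this is `ball'` with the bound
variable made visible. -/
theorem ball {f : (ℕ → N) → N} {P : (ℕ → N) → N → Prop} (hf : IsTm Ω f)
    (hP : IsDef Ω fun v => P (tail v) (v 0)) : IsDef Ω fun v => ∀ z < f v, P v z :=
  ball' hf hP

theorem not (hP : IsDef Ω P) : IsDef Ω fun v => ¬ P v := hP.imp falsum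

theorem of_iff (hP : IsDef Ω P) (h : ∀ v, Q v ↔ P v) : IsDef Ω Q := by
  obtain rfl : Q = P := funext fun v => propext (h v)
  exact hP

theorem and (hP : IsDef Ω P) (hQ : IsDef Ω Q) : IsDef Ω fun v => P v ∧ Q v :=
  (hP.imp hQ.not).not.of_iff fun v => by tauto

theorem or (hP : IsDef Ω P) (hQ : IsDef Ω Q) : IsDef Ω fun v => P v ∨ Q v :=
  (hP.not.imp hQ).of_iff fun v => by tauto

theorem bex {f : (ℕ → N) → N} {P : (ℕ → N) → N → Prop} (hf : IsTm Ω f)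
    (hP : IsDef Ω fun v => P (tail v) (v 0)) : IsDef Ω fun v => ∃ z < f v, P v z :=
  (ball (P := fun v z => ¬ P v z) hf hP.not).not.of_iff fun v => by push Not; rfl

theorem le {f g : (ℕ → N) → N} (hf : IsTm Ω f) (hg : IsTm Ω g) : IsDef Ω fun v => f v ≤ g v :=
  (lt hg hf).not.of_iff fun v => by simp

end IsDef

theorem IsTm.mono {Ω Ω' : Set (N → N)} (h : Ω ⊆ Ω') {f : (ℕ → N) → N} (hf : IsTm Ω f) :
    IsTm Ω' f := by
  induction hf with
  | var i => exact .var i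
  | const c => exact .const c
  | add _ _ h1 h2 => exact h1.add h2
  | mul _ _ h1 h2 => exact h1.mul h2
  | app hg _ h1 => exact h1.app (h hg)

theorem IsDef.mono {Ω Ω' : Set (N → N)} (h : Ω ⊆ Ω') {P : (ℕ → N) → Prop} (hP : IsDef Ω P) :
    IsDef Ω' P := by
  induction hP with
  | falsum => exact .falsum
  | eq hf hg => exact .eq (hf.mono h) (hg.mono h)
  | lt hf hg => exact .lt (hf.mono h) (hg.mono h)
  | imp _ _ h1 h2 => exact h1.imp h2
  | ball' hf _ h1 => exact .ball' (hf.mono h) h1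

theorem HasInd.mono {Ω Ω' : Set (N → N)} (h : Ω ⊆ Ω') (hI : HasInd Ω') : HasInd Ω :=
  fun P hP => hI P (hP.mono h)

/-! Substitution of terms. -/

theorem IsTm.subst {Ω : Set (N → N)} {f : (ℕ → N) → N} (hf : IsTm Ω f)
    {σ : (ℕ → N) → ℕ → N} (hσ : ∀ i, IsTm Ω fun v => σ v i) : IsTm Ω fun v => f (σ v) := by
  induction hf with
  | var i => exact hσ i
  | const c => exact .const c
  | add _ _ h1 h2 => exact h1.add h2
  | mul _ _ h1 h2 => exact h1.mul h2
  | app hg _ h1 => exact h1.app hg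

theorem IsTm.weaken {Ω : Set (N → N)} {f : (ℕ → N) → N} (hf : IsTm Ω f) :
    IsTm Ω fun v => f (tail v) :=
  hf.subst fun i => .var (i + 1)

theorem IsDef.subst_term {Ω : Set (N → N)} {P : (ℕ → N) → Prop} (hP : IsDef Ω P)
    {σ : (ℕ → N) → ℕ → N} (hσ : ∀ i, IsTm Ω fun v => σ v i) : IsDef Ω fun v => P (σ v) := by
  induction hP generalizing σ with
  | falsum => exact .falsum
  | eq hf hg => exact .eq (hf.subst hσ) (hg.subst hσ)
  | lt hf hg => exact .lt (hf.subst hσ) (hg.subst hσ)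
  | imp _ _ h1 h2 => exact (h1 hσ).imp (h2 hσ)
  | @ball' f P hf _ h1 =>
    -- Under the binder the substitution fixes variable 0 and acts on the tail.
    refine .ball (hf.subst hσ) (h1 (σ := fun v => cons (v 0) (σ (tail v))) fun i => ?_)
    cases i with
    | zero => exact .var 0
    | succ i => exact (hσ i).weaken

/-- Terms for the entries of `cons (f v) (σ v)`. -/
theorem IsTm.extend {Ω : Set (N → N)} {f : (ℕ → N) → N} {σ : (ℕ → N) → ℕ → N} (hf : IsTm Ω f)
    (hσ : ∀ i, IsTm Ω fun v => σ v i) : ∀ i, IsTm Ω fun v => cons (f v) (σ v) i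
  | 0 => hf
  | i + 1 => hσ i

/-- Strong induction. -/
theorem HasInd.strong {Ω : Set (N → N)} (hI : HasInd Ω) {P : (ℕ → N) → N → Prop}
    (hP : IsDef Ω fun v => P (tail v) (v 0)) (v : ℕ → N)
    (h : ∀ z, (∀ y < z, P v y) → P v z) (z : N) : P v z := by
  have hQ : IsDef Ω fun v => ∀ y < v 0, P (tail v) y := by
    exact .ball (.var 0) (hP.subst_term (σ := fun v => cons (v 0) (tail (tail v)))
      (IsTm.extend (.var 0) fun i => .var (i + 2)))
  refine h z (hI _ hQ v ?_ ?_ z)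
  · intro y hy
    exact absurd hy (not_lt.2 (zero_le (a := y)))
  · intro z hz y hy
    rcases (lt_succ_iff.1 hy).lt_or_eq with h1 | rfl
    · exact hz y h1
    · exact h _ hz

end

/-! ### Bounded formulas and bounded predicates -/

theorem realize_inductionAx_iff {N : Type} {A : ArithOps N} {b : Bool}
    [(arith b).Structure N] (h : A.Interprets b) {n : ℕ} (φ : Fm b (n + 1)) :
    (N ⊨ inductionAx φ) ↔ ∀ xs : Fin n → N,
      φ.Realize default (Fin.snoc xs A.zero : Fin (n + 1) → N) →
      (∀ z, φ.Realize default (Fin.snoc xs z : Fin (n + 1) → N) →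
        φ.Realize default (Fin.snoc xs (A.add z A.one) : Fin (n + 1) → N)) →
      ∀ z, φ.Realize default (Fin.snoc xs z : Fin (n + 1) → N) := by
  have e1 : ∀ xs : Fin n → N, (fun i =>
      ((Fin.snoc (α := fun _ => Tm b n) bv 0 : Fin (n + 1) → Tm b n) i).realize
        (Sum.elim (default : Empty → N) xs)) = (Fin.snoc xs A.zero : Fin (n + 1) → N) := by
    intro xs
    funext i
    refine Fin.lastCases ?_ (fun i => ?_) i
    · simp only [Fin.snoc_last]; exact h.zero
    · simp only [Fin.snoc_castSucc]; rfl
  have e2 : ∀ (xs : Fin n → N) (z : N),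
      (fun i => ((Fin.snoc (α := fun _ => Tm b (n + 1)) (fun i => bv i.castSucc) (lastV + 1) :
        Fin (n + 1) → Tm b (n + 1)) i).realize
          (Sum.elim (default : Empty → N) (Fin.snoc xs z : Fin (n + 1) → N))) =
      (Fin.snoc xs (A.add z A.one) : Fin (n + 1) → N) := by
    intro xs z
    funext i
    refine Fin.lastCases ?_ (fun i => ?_) i
    · simp only [Fin.snoc_last, h.add, h.one, realize_lastV]
    · simp only [Fin.snoc_castSucc, realize_bv]
  unfold inductionAx Sentence.Realize Formula.Realize
  refine (BoundedFormula.realize_alls).trans ?_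
  simp only [BoundedFormula.realize_imp, BoundedFormula.realize_inf, BoundedFormula.realize_all,
    realize_inst, e1, e2, and_imp]

/-! ### From bounded predicates back to Δ₀ formulas. -/

section

variable {N : Type}

/-- The first `k` values are the parameters `q 0, …, q (k - 1)`; the others are, in reverse order,
the first entries of the sequence `v`. -/
def env (q : ℕ → N) (k m : ℕ) (v : ℕ → N) : Fin m → N :=
  fun j => if (j : ℕ) < k then q j else v (m - 1 - j)

/-- A quantifier binds the last variable of a formula but the head of a sequence. The reversed order
in `env` makes both extensions agree while the parameters keep their places. -/
theorem snoc_env (q : ℕ → N) {k m : ℕ} (h : k ≤ m) (v : ℕ → N) (z : N) :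
    (Fin.snoc (env q k m v) z : Fin (m + 1) → N) = env q k (m + 1) (cons z v) := by
  funext j
  refine Fin.lastCases ?_ (fun j => ?_) j
  · simp [env, not_lt.2 h, cons]
  · have e : m + 1 - 1 - (j : ℕ) = (m - 1 - j) + 1 := by omega
    simp only [Fin.snoc_castSucc, env, Fin.val_castSucc, e, cons]

variable [DiscreteSemiring N] {b : Bool} {om : N → N}

/-- The unary functions named by symbols of `arith b`. -/
def symbols (b : Bool) (om : N → N) : Set (N → N) := {g | b = true ∧ g = om}

variable [(arith b).Structure N] (h : (semiringOps N om).Interprets b)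
include h

/-- Constants become variables. The set `s` and the number `n` are found before the parameter list
`q` is chosen, so that subterms with different constants can share one list. -/
theorem IsTm.exists_term {f : (ℕ → N) → N} (hf : IsTm (symbols b om) f) :
    ∃ (s : Finset N) (n : ℕ), ∀ (q : ℕ → N) (k : ℕ), (∀ c ∈ s, ∃ i < k, q i = c) →
      ∀ m, k + n ≤ m → ∃ t : Tm b m, ∀ v, t.realize (Sum.elim default (env q k m v)) = f v := by
  classical
  induction hf with
  | var i =>
    refine ⟨∅, i + 1, fun q k _ m hm => ⟨bv ⟨m - 1 - i, by omega⟩, fun v => ?_⟩⟩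
    have h1 : ¬ m - 1 - i < k := by omega
    have h2 : m - 1 - (m - 1 - i) = i := by omega
    simp [realize_bv, env, h1, h2]
  | const c =>
    refine ⟨{c}, 0, fun q k hq m hm => ?_⟩
    obtain ⟨i, hi, rfl⟩ := hq c (by simp)
    exact ⟨bv ⟨i, by omega⟩, fun v => by simp [realize_bv, env, hi]⟩
  | add _ _ h1 h2 =>
    obtain ⟨s1, n1, h1⟩ := h1
    obtain ⟨s2, n2, h2⟩ := h2
    refine ⟨s1 ∪ s2, max n1 n2, fun q k hq m hm => ?_⟩
    obtain ⟨t1, h1⟩ := h1 q k (fun c hc => hq c (by simp [hc])) m (by omega)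
    obtain ⟨t2, h2⟩ := h2 q k (fun c hc => hq c (by simp [hc])) m (by omega)
    exact ⟨t1 + t2, fun v => by rw [h.add, h1, h2]; rfl⟩
  | mul _ _ h1 h2 =>
    obtain ⟨s1, n1, h1⟩ := h1
    obtain ⟨s2, n2, h2⟩ := h2
    refine ⟨s1 ∪ s2, max n1 n2, fun q k hq m hm => ?_⟩
    obtain ⟨t1, h1⟩ := h1 q k (fun c hc => hq c (by simp [hc])) m (by omega)
    obtain ⟨t2, h2⟩ := h2 q k (fun c hc => hq c (by simp [hc])) m (by omega)
    exact ⟨t1 * t2, fun v => by rw [h.mul, h1, h2]; rfl⟩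
  | app hg _ h1 =>
    obtain ⟨rfl, rfl⟩ := hg
    obtain ⟨s1, n1, h1⟩ := h1
    refine ⟨s1, n1, fun q k hq m hm => ?_⟩
    obtain ⟨t1, h1⟩ := h1 q k hq m hm
    exact ⟨omT t1, fun v => by rw [h.omT, h1]; rfl⟩

theorem IsDef.exists_formula {P : (ℕ → N) → Prop} (hP : IsDef (symbols b om) P) :
    ∃ (s : Finset N) (n : ℕ), ∀ (q : ℕ → N) (k : ℕ), (∀ c ∈ s, ∃ i < k, q i = c) →
      ∀ m, k + n ≤ m → ∃ φ : Fm b m, IsDelta0 φ ∧ ∀ v, φ.Realize default (env q k m v) ↔ P v := by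
  classical
  induction hP with
  | falsum => exact ⟨∅, 0, fun q k _ m _ => ⟨⊥, .falsum, fun v => Iff.rfl⟩⟩
  | eq h1 h2 =>
    obtain ⟨s1, n1, h1⟩ := h1.exists_term h
    obtain ⟨s2, n2, h2⟩ := h2.exists_term h
    refine ⟨s1 ∪ s2, max n1 n2, fun q k hq m hm => ?_⟩
    obtain ⟨t1, h1⟩ := h1 q k (fun c hc => hq c (by simp [hc])) m (by omega)
    obtain ⟨t2, h2⟩ := h2 q k (fun c hc => hq c (by simp [hc])) m (by omega)
    exact ⟨t1 =' t2, .equal _ _, fun v => by rw [BoundedFormula.realize_bdEqual, h1, h2]⟩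
  | lt h1 h2 =>
    obtain ⟨s1, n1, h1⟩ := h1.exists_term h
    obtain ⟨s2, n2, h2⟩ := h2.exists_term h
    refine ⟨s1 ∪ s2, max n1 n2, fun q k hq m hm => ?_⟩
    obtain ⟨t1, h1⟩ := h1 q k (fun c hc => hq c (by simp [hc])) m (by omega)
    obtain ⟨t2, h2⟩ := h2 q k (fun c hc => hq c (by simp [hc])) m (by omega)
    exact ⟨ltF t1 t2, .lt _ _, fun v => by rw [h.ltF, h1, h2]; rfl⟩
  | imp _ _ h1 h2 =>
    obtain ⟨s1, n1, h1⟩ := h1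
    obtain ⟨s2, n2, h2⟩ := h2
    refine ⟨s1 ∪ s2, max n1 n2, fun q k hq m hm => ?_⟩
    obtain ⟨φ, hφ, h1⟩ := h1 q k (fun c hc => hq c (by simp [hc])) m (by omega)
    obtain ⟨ψ, hψ, h2⟩ := h2 q k (fun c hc => hq c (by simp [hc])) m (by omega)
    exact ⟨φ ⟹ ψ, hφ.imp hψ, fun v => by rw [BoundedFormula.realize_imp, h1, h2]⟩
  | ball' h1 _ h2 =>
    obtain ⟨s1, n1, h1⟩ := h1.exists_term h
    obtain ⟨s2, n2, h2⟩ := h2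
    refine ⟨s1 ∪ s2, max n1 n2, fun q k hq m hm => ?_⟩
    obtain ⟨t, h1⟩ := h1 q k (fun c hc => hq c (by simp [hc])) m (by omega)
    obtain ⟨φ, hφ, h2⟩ := h2 q k (fun c hc => hq c (by simp [hc])) (m + 1) (by omega)
    refine ⟨ballF t φ, .ball _ hφ, fun v => ?_⟩
    simp only [h.ballF, h1, snoc_env q (show k ≤ m by omega), h2]
    rfl

/-- Induction for bounded predicates follows from the axioms of induction. -/
theorem hasInd_of_models (H : ∀ (n : ℕ) (φ : Fm b (n + 1)), IsDelta0 φ → N ⊨ inductionAx φ) :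
    HasInd (symbols b om) := by
  intro P hP v h0 hs z
  obtain ⟨s, n, hn⟩ := hP.exists_formula h
  -- The parameters are the elements of `s` and the first `n` entries of `v`; the one further
  -- variable, the last, carries the induction.
  obtain ⟨φ, hφ, hr⟩ := hn (fun i => s.toList.getD i 0) s.card (fun c hc => by
    obtain ⟨i, hi, rfl⟩ := List.mem_iff_getElem.1 (Finset.mem_toList.2 hc)
    exact ⟨i, by simpa using hi, List.getD_eq_getElem _ _ hi⟩) (s.card + n + 1) (by omega)
  have H := (realize_inductionAx_iff h φ).1 (H _ φ hφ)
    (env (fun i => s.toList.getD i 0) s.card (s.card + n) v)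
  simp only [snoc_env _ (show s.card ≤ s.card + n by omega), hr] at H
  exact H h0 hs z

end

/-! ### Functions with bounded graphs -/

section

variable {N : Type}

theorem cons_tail (v : ℕ → N) : cons (v 0) (tail v) = v := by
  funext i
  cases i <;> rfl

variable [DiscreteSemiring N]

/-- Functions that are bounded by a term and have a bounded graph. -/
structure IsGood (Ω : Set (N → N)) (f : (ℕ → N) → N) : Prop where
  bound : ∃ t, IsTm Ω t ∧ ∀ v, f v ≤ t v
  graph : IsDef Ω fun v => v 0 = f (tail v)

variable {Ω : Set (N → N)}

theorem IsTm.isGood {f : (ℕ → N) → N} (hf : IsTm Ω f) : IsGood Ω f :=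
  ⟨⟨f, hf, fun _ => le_rfl⟩, .eq (.var 0) hf.weaken⟩

/-- The value of a good function may be used in bounded predicates. -/
theorem IsDef.bind {f : (ℕ → N) → N} {Q : (ℕ → N) → N → Prop} (hf : IsGood Ω f)
    (hQ : IsDef Ω fun v => Q (tail v) (v 0)) : IsDef Ω fun v => Q v (f v) := by
  obtain ⟨⟨t, ht, hb⟩, hg⟩ := hf
  -- The term bound `f v ≤ t v` makes the quantifier over the value a bounded one.
  refine (IsDef.bex (P := fun v z => z = f v ∧ Q v z) (ht.add (.const 1))
    (hg.and hQ)).of_iff fun v => ?_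
  constructor
  · exact fun h => ⟨f v, lt_succ_iff.2 (hb v), rfl, h⟩
  · rintro ⟨_, _, rfl, h⟩
    exact h

theorem IsGood.weaken {f : (ℕ → N) → N} (hf : IsGood Ω f) : IsGood Ω fun v => f (tail v) := by
  obtain ⟨⟨t, ht, hb⟩, hg⟩ := hf
  refine ⟨⟨_, ht.weaken, fun v => hb _⟩, ?_⟩
  exact hg.subst_term (σ := fun v => cons (v 0) (tail (tail v)))
    (IsTm.extend (.var 0) fun i => .var (i + 2))

theorem IsGood.extend {f : (ℕ → N) → N} {σ : (ℕ → N) → ℕ → N} (hf : IsGood Ω f)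
    (hσ : ∀ i, IsGood Ω fun v => σ v i) : ∀ i, IsGood Ω fun v => cons (f v) (σ v) i
  | 0 => hf
  | i + 1 => hσ i

theorem IsGood.lift {σ : (ℕ → N) → ℕ → N} (hσ : ∀ i, IsGood Ω fun v => σ v i) :
    ∀ i, IsGood Ω fun v => cons (v 0) (σ (tail v)) i :=
  IsGood.extend (IsTm.var 0).isGood fun i => (hσ i).weaken

/-- A predicate applied to two good functions. -/
theorem IsDef.bind₂ {f g : (ℕ → N) → N} {R : N → N → Prop} (hf : IsGood Ω f) (hg : IsGood Ω g)
    (hR : IsDef Ω fun v => R (v 1) (v 0)) : IsDef Ω fun v => R (f v) (g v) := by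
  refine .bind (Q := fun v z => R z (g v)) hf (.bind (Q := fun v z => R (v 0) z) hg.weaken ?_)
  exact hR

theorem IsDef.eq_good {f g : (ℕ → N) → N} (hf : IsGood Ω f) (hg : IsGood Ω g) :
    IsDef Ω fun v => f v = g v :=
  .bind₂ hf hg (.eq (.var 1) (.var 0))

theorem IsDef.lt_good {f g : (ℕ → N) → N} (hf : IsGood Ω f) (hg : IsGood Ω g) :
    IsDef Ω fun v => f v < g v :=
  .bind₂ hf hg (.lt (.var 1) (.var 0))

theorem IsDef.ball_good {f : (ℕ → N) → N} {P : (ℕ → N) → N → Prop} (hf : IsGood Ω f)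
    (hP : IsDef Ω fun v => P (tail v) (v 0)) : IsDef Ω fun v => ∀ z < f v, P v z :=
  .bind (Q := fun v y => ∀ z < y, P v z) hf <| .ball (.var 0) <|
    hP.subst_term (σ := fun v => cons (v 0) (tail (tail v)))
      (IsTm.extend (.var 0) fun i => .var (i + 2))

theorem IsGood.add {f g : (ℕ → N) → N} (hf : IsGood Ω f) (hg : IsGood Ω g) :
    IsGood Ω fun v => f v + g v := by
  obtain ⟨⟨t, ht, hft⟩, -⟩ := id hf
  obtain ⟨⟨s, hs, hgs⟩, -⟩ := id hg
  refine ⟨⟨_, ht.add hs, fun v => add_le_add (hft v) (hgs v)⟩, ?_⟩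
  -- Each binding shifts the indices: in the end 0 is the value of `g`, 1 the value of `f`, and 2
  -- the graph variable.
  refine .bind (Q := fun v z => v 0 = z + g (tail v)) hf.weaken ?_
  refine .bind (Q := fun v z => v 1 = v 0 + z) hg.weaken.weaken ?_
  exact .eq (.var 2) (.add (.var 1) (.var 0))

theorem IsGood.mul {f g : (ℕ → N) → N} (hf : IsGood Ω f) (hg : IsGood Ω g) :
    IsGood Ω fun v => f v * g v := by
  obtain ⟨⟨t, ht, hft⟩, -⟩ := id hf
  obtain ⟨⟨s, hs, hgs⟩, -⟩ := id hg
  refine ⟨⟨_, ht.mul hs, fun v => mul_le_mul' (hft v) (hgs v)⟩, ?_⟩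
  refine .bind (Q := fun v z => v 0 = z * g (tail v)) hf.weaken ?_
  refine .bind (Q := fun v z => v 1 = v 0 * z) hg.weaken.weaken ?_
  exact .eq (.var 2) (.mul (.var 1) (.var 0))

/-! ### Composition of good functions when the function symbols are monotone. -/

variable (hΩ : ∀ g ∈ Ω, Monotone g)
include hΩ

theorem IsTm.monotone {f : (ℕ → N) → N} (hf : IsTm Ω f) : Monotone f := by
  induction hf with
  | var i => exact fun v w h => h i
  | const c => exact fun v w h => le_rfl
  | add _ _ h1 h2 => exact fun v w h => add_le_add (h1 h) (h2 h)
  | mul _ _ h1 h2 => exact fun v w h => mul_le_mul' (h1 h) (h2 h)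
  | app hg _ h1 => exact fun v w h => hΩ _ hg (h1 h)

theorem IsTm.subst_good {f : (ℕ → N) → N} (hf : IsTm Ω f) {σ : (ℕ → N) → ℕ → N}
    (hσ : ∀ i, IsGood Ω fun v => σ v i) : IsGood Ω fun v => f (σ v) := by
  induction hf with
  | var i => exact hσ i
  | const c => exact (IsTm.const c).isGood
  | add _ _ h1 h2 => exact h1.add h2
  | mul _ _ h1 h2 => exact h1.mul h2
  | @app g f hg _ h1 =>
    obtain ⟨⟨t, ht, hft⟩, -⟩ := id h1
    refine ⟨⟨_, ht.app hg, fun v => hΩ g hg (hft v)⟩, ?_⟩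
    refine .bind (Q := fun v z => v 0 = g z) h1.weaken ?_
    exact .eq (.var 1) (.app hg (.var 0))

/-- Values of good functions lie below terms, so bounded quantifiers can introduce them, in atomic
formulas as well as in quantifier bounds. -/
theorem IsDef.subst {P : (ℕ → N) → Prop} (hP : IsDef Ω P) {σ : (ℕ → N) → ℕ → N}
    (hσ : ∀ i, IsGood Ω fun v => σ v i) : IsDef Ω fun v => P (σ v) := by
  induction hP generalizing σ with
  | falsum => exact .falsum
  | eq hf hg => exact .eq_good (hf.subst_good hΩ hσ) (hg.subst_good hΩ hσ)
  | lt hf hg => exact .lt_good (hf.subst_good hΩ hσ) (hg.subst_good hΩ hσ)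
  | imp _ _ h1 h2 => exact (h1 hσ).imp (h2 hσ)
  | ball' hf _ h1 => exact .ball_good (hf.subst_good hΩ hσ) (h1 (IsGood.lift hσ))

/-- Terms are monotone, so the outer bound evaluated at the inner bounds is a bound for the
composite. -/
theorem IsGood.subst {f : (ℕ → N) → N} (hf : IsGood Ω f) {σ : (ℕ → N) → ℕ → N}
    (hσ : ∀ i, IsGood Ω fun v => σ v i) : IsGood Ω fun v => f (σ v) := by
  obtain ⟨⟨t, ht, hft⟩, hg⟩ := hf
  choose s hs hσs using fun i => (hσ i).bound
  refine ⟨⟨fun v => t fun i => s i v, ht.subst hs, fun v => ?_⟩, ?_⟩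
  · exact (hft _).trans (ht.monotone hΩ fun i => hσs i v)
  · exact hg.subst hΩ (IsGood.lift hσ)

/-- A unary function with a good graph may be applied to good functions. -/
theorem IsGood.comp {g : N → N} (hg : IsGood Ω fun v => g (v 0)) {f : (ℕ → N) → N}
    (hf : IsGood Ω f) : IsGood Ω fun v => g (f v) :=
  hg.subst hΩ (σ := fun v => cons (f v) v) (IsGood.extend hf fun i => (IsTm.var i).isGood)

end

/-! ### Bounded minimization -/

section

variable {N : Type} [DiscreteSemiring N] {Ω : Set (N → N)}

/-- `r` is the least `m < T` with `P m`, or `T` if there is none. -/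
def IsMu (r T : N) (P : N → Prop) : Prop :=
  ¬ T < r ∧ (∀ m, m < r → ¬ P m) ∧ (r < T → ∀ m, m = r → P m)

theorem IsMu.unique {r r' T : N} {P : N → Prop} (h : IsMu r T P) (h' : IsMu r' T P) : r = r' := by
  rcases lt_trichotomy r r' with h1 | h1 | h1
  · exact (h'.2.1 r h1 (h.2.2 (h1.trans_le (not_lt.1 h'.1)) r rfl)).elim
  · exact h1
  · exact (h.2.1 r' h1 (h'.2.2 (h1.trans_le (not_lt.1 h.1)) r' rfl)).elim

open Classical in
/-- The least `m < T` with `P m`, or `T` if there is none. -/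
noncomputable def mu (T : N) (P : N → Prop) : N :=
  -- The default `0` is never reached for bounded predicates, by `HasInd.exists_isMu`.
  if h : ∃ r, IsMu r T P then h.choose else 0

theorem isMu_iff {T : N} {P : N → Prop} (h : ∃ r, IsMu r T P) (r : N) :
    IsMu r T P ↔ r = mu T P := by
  have h1 : IsMu (mu T P) T P := by
    rw [mu, dif_pos h]
    exact h.choose_spec
  exact ⟨fun h2 => h2.unique h1, fun h2 => h2 ▸ h1⟩

/-- Least number principle: if no `r` qualified, strong induction would refute `P` at every `z ≤ T`,
and then `T` itself would qualify. -/
theorem HasInd.exists_isMu (hI : HasInd Ω) {P : (ℕ → N) → N → Prop}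
    (hP : IsDef Ω fun v => P (tail v) (v 0)) (v : ℕ → N) (T : N) : ∃ r, IsMu r T (P v) := by
  by_contra hne
  have h : ∀ z, ¬ P v z ∨ T < z := by
    refine hI.strong (P := fun v z => ¬ P v z ∨ T < z) (hP.not.or (.lt (.const T) (.var 0))) v ?_
    intro z hz
    by_contra hc
    push Not at hc
    refine hne ⟨z, not_lt.2 hc.2, fun m hm hPm => ?_, fun _ m hm => hm ▸ hc.1⟩
    exact (hz m hm).elim (fun h1 => h1 hPm) fun h1 => absurd (h1.trans hm) (not_lt.2 hc.2)
  refine hne ⟨T, lt_irrefl _, fun m hm hPm => ?_, fun h1 => absurd h1 (lt_irrefl _)⟩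
  exact (h m).elim (fun h1 => h1 hPm) fun h1 => lt_asymm hm h1

theorem HasInd.isMu_iff (hI : HasInd Ω) {P : (ℕ → N) → N → Prop}
    (hP : IsDef Ω fun v => P (tail v) (v 0)) (v : ℕ → N) (T r : N) :
    IsMu r T (P v) ↔ r = mu T (P v) :=
  LimitedExp.isMu_iff (hI.exists_isMu hP v T) r

/-- The value is at most `T v`, and `IsMu` is itself a bounded condition, which serves as the graph.
-/
theorem HasInd.isGood_mu (hI : HasInd Ω) {P : (ℕ → N) → N → Prop}
    (hP : IsDef Ω fun v => P (tail v) (v 0)) {T : (ℕ → N) → N} (hT : IsGood Ω T) :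
    IsGood Ω fun v => mu (T v) (P v) := by
  obtain ⟨⟨t, ht, hTt⟩, -⟩ := id hT
  have hle : ∀ v, mu (T v) (P v) ≤ T v := fun v =>
    not_lt.1 ((hI.isMu_iff hP v (T v) _).2 rfl).1
  refine ⟨⟨t, ht, fun v => (hle v).trans (hTt v)⟩, ?_⟩
  refine IsDef.of_iff ?_ fun v => (hI.isMu_iff hP (tail v) _ _).symm
  refine .and (IsDef.lt_good hT.weaken (IsTm.var 0).isGood).not (.and ?_ (.imp ?_ ?_))
  · exact .ball (P := fun v m => ¬ P (tail v) m) (.var 0)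
      (hP.subst_term (σ := fun v => cons (v 0) (tail (tail v)))
        (IsTm.extend (.var 0) fun i => .var (i + 2))).not
  · exact .lt_good (IsTm.var 0).isGood hT.weaken
  · exact hP.of_iff fun v => by simp

end

/-! ### The graph of `x ↦ x ^ len x` -/

section

variable {N : Type} [DiscreteSemiring N]

/-- `u` is a power of two or `0`. -/
def PowTwo (u : N) : Prop :=
  ∀ d < u + 1, (∃ c < u + 1, u = d * c) → (d = 1 ∨ ∃ h < d + 1, d = h + h)

/-- `e` is the digit of `z` at position `u`. -/
def Digit (z u e : N) : Prop :=
  e < u ∧ ∃ q < z + 1, ∃ r < u, z = (q * u + e) * u + r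

/-- `(k, e)` is the entry at `u` of the chain coded by `U, K, E`. -/
def Entry (U K E u k e : N) : Prop :=
  PowTwo u ∧ Digit U u 1 ∧ Digit K u k ∧ Digit E u e

/-- `U, K, E` code a chain for the powers of `a`. -/
def Chain (B a U K E : N) : Prop :=
  ∀ u < B, ∀ k < B, ∀ e < B, Entry U K E u k e →
    (k = 0 ∧ e = 1) ∨ ∃ u' < u, ∃ k' < B, ∃ e' < B, Entry U K E u' k' e' ∧
      ((k = k' + k' ∧ e = e' * e') ∨ (k = k' + k' + 1 ∧ e = e' * e' * a))

/-- `y = a ^ k`, with a code below `B`. -/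
def PowRel (B a k y : N) : Prop :=
  ∃ U < B, ∃ K < B, ∃ E < B, Chain B a U K E ∧ ∃ u < B, Entry U K E u k y

/-- `t ^ 8`. -/
def pow8' (t : N) : N := ((t * t) * (t * t)) * ((t * t) * (t * t))

/-- `y = x ^ len x`. -/
def OmegaRel (x y : N) : Prop :=
  ∃ k < x + 1, ∃ p < x + x + 1 + 1, x < p ∧
    PowRel (pow8' (x + y + 1 + 1)) (1 + 1) k p ∧ PowRel (pow8' (x + y + 1 + 1)) x k y

/-! ### The graph formulas express these relations. -/

section Realize

variable {b : Bool} {om : N → N} [(arith b).Structure N] (h : (semiringOps N om).Interprets b)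
  {n : ℕ} {w : Empty → N} {xs : Fin n → N}
include h

theorem realize_pow2F (u : Tm b n) :
    (pow2F u).Realize w xs ↔ PowTwo (u.realize (Sum.elim w xs)) := by
  simp only [pow2F, h.ballF, h.bexF, h.add, h.mul, h.one, realize_up, realize_lastV,
    BoundedFormula.realize_imp, BoundedFormula.realize_sup, BoundedFormula.realize_bdEqual]
  rfl

theorem realize_digitF (z u e : Tm b n) :
    (digitF z u e).Realize w xs ↔ Digit (z.realize (Sum.elim w xs)) (u.realize (Sum.elim w xs))
      (e.realize (Sum.elim w xs)) := by
  simp only [digitF, h.ltF, h.bexF, h.add, h.mul, h.one, realize_up, realize_lastV,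
    BoundedFormula.realize_inf, BoundedFormula.realize_bdEqual]
  rfl

theorem realize_entryF (U K E u k e : Tm b n) :
    (entryF U K E u k e).Realize w xs ↔ Entry (U.realize (Sum.elim w xs))
      (K.realize (Sum.elim w xs)) (E.realize (Sum.elim w xs)) (u.realize (Sum.elim w xs))
      (k.realize (Sum.elim w xs)) (e.realize (Sum.elim w xs)) := by
  simp only [entryF, realize_pow2F h, realize_digitF h, BoundedFormula.realize_inf, h.one]
  rfl

theorem realize_chainF (B a U K E : Tm b n) :
    (chainF B a U K E).Realize w xs ↔ Chain (B.realize (Sum.elim w xs))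
      (a.realize (Sum.elim w xs)) (U.realize (Sum.elim w xs)) (K.realize (Sum.elim w xs))
      (E.realize (Sum.elim w xs)) := by
  simp only [chainF, realize_entryF h, h.ballF, h.bexF, h.add, h.mul, h.one, h.zero, realize_up,
    realize_lastV, BoundedFormula.realize_imp, BoundedFormula.realize_sup,
    BoundedFormula.realize_inf, BoundedFormula.realize_bdEqual]
  rfl

theorem realize_powF (B a k y : Tm b n) :
    (powF B a k y).Realize w xs ↔ PowRel (B.realize (Sum.elim w xs))
      (a.realize (Sum.elim w xs)) (k.realize (Sum.elim w xs)) (y.realize (Sum.elim w xs)) := by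
  simp only [powF, realize_entryF h, realize_chainF h, h.bexF, realize_up, realize_lastV,
    BoundedFormula.realize_inf]
  rfl

theorem realize_omegaF (x y : Tm b n) :
    (omegaF x y).Realize w xs ↔
      OmegaRel (x.realize (Sum.elim w xs)) (y.realize (Sum.elim w xs)) := by
  simp only [omegaF, pow8, realize_powF h, h.bexF, h.ltF, h.add, h.mul, h.one, realize_up,
    realize_lastV, BoundedFormula.realize_inf]
  rfl

end Realize

/-! The relations are bounded. -/

section Definable

variable {Ω : Set (N → N)} {z u e U K E k B a x y : (ℕ → N) → N}

theorem IsDef.powTwo (hu : IsTm Ω u) : IsDef Ω fun v => PowTwo (u v) :=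
  .ball (hu.add (.const 1)) <| .imp
    (.bex (hu.weaken.add (.const 1)) (.eq hu.weaken.weaken (.mul (.var 1) (.var 0))))
    (.or (.eq (.var 0) (.const 1)) (.bex (.add (.var 0) (.const 1))
      (.eq (.var 1) (.add (.var 0) (.var 0)))))

theorem IsDef.digit (hz : IsTm Ω z) (hu : IsTm Ω u) (he : IsTm Ω e) :
    IsDef Ω fun v => Digit (z v) (u v) (e v) :=
  .and (.lt he hu) <| .bex (hz.add (.const 1)) <| .bex hu.weaken <|
    .eq hz.weaken.weaken ((((IsTm.var 1).mul hu.weaken.weaken).add he.weaken.weaken).mul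
      hu.weaken.weaken |>.add (.var 0))

theorem IsDef.entry (hU : IsTm Ω U) (hK : IsTm Ω K) (hE : IsTm Ω E) (hu : IsTm Ω u)
    (hk : IsTm Ω k) (he : IsTm Ω e) :
    IsDef Ω fun v => Entry (U v) (K v) (E v) (u v) (k v) (e v) :=
  .and (.powTwo hu) <| .and (.digit hU hu (.const 1)) <| .and (.digit hK hu hk) (.digit hE hu he)

theorem IsDef.chain (hB : IsTm Ω B) (ha : IsTm Ω a) (hU : IsTm Ω U) (hK : IsTm Ω K)
    (hE : IsTm Ω E) : IsDef Ω fun v => Chain (B v) (a v) (U v) (K v) (E v) := by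
  refine .ball hB <| .ball hB.weaken <| .ball hB.weaken.weaken <| .imp
    (.entry hU.weaken.weaken.weaken hK.weaken.weaken.weaken hE.weaken.weaken.weaken
      (.var 2) (.var 1) (.var 0)) <|
    .or (.and (.eq (.var 1) (.const 0)) (.eq (.var 0) (.const 1))) <|
    .bex (.var 2) <| .bex hB.weaken.weaken.weaken.weaken <|
    .bex hB.weaken.weaken.weaken.weaken.weaken <| .and ?_ <| .or
      (.and (.eq (.var 4) (.add (.var 1) (.var 1))) (.eq (.var 3) (.mul (.var 0) (.var 0))))
      (.and (.eq (.var 4) (.add (.add (.var 1) (.var 1)) (.const 1)))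
        (.eq (.var 3) (.mul (.mul (.var 0) (.var 0))
          ha.weaken.weaken.weaken.weaken.weaken.weaken)))
  exact .entry hU.weaken.weaken.weaken.weaken.weaken.weaken
    hK.weaken.weaken.weaken.weaken.weaken.weaken hE.weaken.weaken.weaken.weaken.weaken.weaken
    (.var 2) (.var 1) (.var 0)

theorem IsDef.powRel (hB : IsTm Ω B) (ha : IsTm Ω a) (hk : IsTm Ω k) (hy : IsTm Ω y) :
    IsDef Ω fun v => PowRel (B v) (a v) (k v) (y v) :=
  .bex hB <| .bex hB.weaken <| .bex hB.weaken.weaken <| .and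
    (.chain hB.weaken.weaken.weaken ha.weaken.weaken.weaken (.var 2) (.var 1) (.var 0)) <|
    .bex hB.weaken.weaken.weaken <| .entry (.var 3) (.var 2) (.var 1) (.var 0)
      hk.weaken.weaken.weaken.weaken hy.weaken.weaken.weaken.weaken

theorem IsTm.pow8 (ht : IsTm Ω z) : IsTm Ω fun v => pow8' (z v) :=
  ((ht.mul ht).mul (ht.mul ht)).mul ((ht.mul ht).mul (ht.mul ht))

theorem IsDef.omegaRel (hx : IsTm Ω x) (hy : IsTm Ω y) :
    IsDef Ω fun v => OmegaRel (x v) (y v) := by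
  have hB := (((hx.add hy).add (.const 1)).add (.const 1)).pow8.weaken.weaken
  exact .bex (hx.add (.const 1)) <| .bex (((hx.add hx).add (.const 1)).add (.const 1)).weaken <|
    .and (.lt hx.weaken.weaken (.var 0)) <|
    .and (.powRel hB (.const _) (.var 1) (.var 0)) (.powRel hB hx.weaken.weaken (.var 1)
      hy.weaken.weaken)

end Definable

/-! Monotonicity. -/

theorem le_of_double_le {i j : N} (h : i + i ≤ j + j + 1) : i ≤ j := by
  by_contra hc
  have h1 := succ_le_iff'.2 (not_le.1 hc)
  have h2 := zero_lt_one (α := N)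
  grind

theorem lt_of_double_lt {i j : N} (h : i + i < j + j) : i < j := by
  grind

variable (hI : HasInd (∅ : Set (N → N)))

theorem Entry.lt {U K E u k e : N} (h : Entry U K E u k e) : k < u ∧ e < u :=
  ⟨h.2.2.1.1, h.2.2.2.1⟩

include hI

/-- Strong induction on the position: an entry with exponent 0 is initial or the square of an
earlier one with exponent 0, since `k' + k' + 1` is not 0. -/
theorem Chain.eq_one {B a U K E : N} (hC : Chain B a U K E) {u e : N} (hu : u < B)
    (h : Entry U K E u 0 e) : e = 1 := by
  have key : ∀ u, u < B → ∀ e < B, Entry U K E u 0 e → e = 1 := by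
    refine hI.strong (P := fun _ u => u < B → ∀ e < B, Entry U K E u 0 e → e = 1) ?_
      (fun _ => 0) ?_
    · exact .imp (.lt (.var 0) (.const B)) <| .ball (.const B) <| .imp
        (.entry (.const _) (.const _) (.const _) (.var 1) (.const _) (.var 0))
        (.eq (.var 0) (.const 1))
    · intro u ih hu e he h
      rcases hC u hu 0 (lt_of_le_of_lt (zero_le) hu) e he h with
        ⟨-, rfl⟩ | ⟨v, hv, j, hj, d, hd, hE, ⟨h1, rfl⟩ | ⟨h1, -⟩⟩
      · rfl
      · obtain ⟨rfl, -⟩ := add_eq_zero.1 h1.symm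
        rw [ih v hv (hv.trans hu) d hd hE, mul_one]
      · exact absurd (add_eq_zero.1 h1.symm).2 one_ne_zero
  exact key u hu e (h.lt.2.trans hu) h

/-- Values start at 1 and are only squared or multiplied by `a ≥ 1`; the exponent becomes positive
only at a step that multiplies by `a`. -/
theorem Chain.le_entry {B a U K E : N} (hC : Chain B a U K E) (ha : 1 ≤ a) {u k e : N} (hu : u < B)
    (h : Entry U K E u k e) : 1 ≤ e ∧ (0 < k → a ≤ e) := by
  have key : ∀ u, u < B → ∀ k < B, ∀ e < B, Entry U K E u k e → 1 ≤ e ∧ (0 < k → a ≤ e) := by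
    refine hI.strong (P := fun _ u => u < B → ∀ k < B, ∀ e < B, Entry U K E u k e →
      1 ≤ e ∧ (0 < k → a ≤ e)) ?_ (fun _ => 0) ?_
    · exact .imp (.lt (.var 0) (.const B)) <| .ball (.const B) <| .ball (.const B) <| .imp
        (.entry (.const _) (.const _) (.const _) (.var 2) (.var 1) (.var 0))
        (.and (.le (.const 1) (.var 0))
          (.imp (.lt (.const 0) (.var 1)) (.le (.const a) (.var 0))))
    · intro u ih hu k hk e he h
      rcases hC u hu k hk e he h with
        ⟨rfl, rfl⟩ | ⟨v, hv, j, hj, d, hd, hE, ⟨rfl, rfl⟩ | ⟨rfl, rfl⟩⟩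
      · exact ⟨le_rfl, fun h => absurd h (lt_irrefl _)⟩
      · obtain ⟨h1, h2⟩ := ih v hv (hv.trans hu) j hj d hd hE
        refine ⟨one_le_mul h1 h1, fun h3 => ?_⟩
        have h4 : 0 < j := by
          rcases (zero_le (a := j)).eq_or_lt with h5 | h5
          · subst h5
            simp at h3
          · exact h5
        exact (h2 h4).trans (le_mul_of_one_le_right' h1)
      · obtain ⟨h1, -⟩ := ih v hv (hv.trans hu) j hj d hd hE
        have h2 := one_le_mul h1 h1
        exact ⟨one_le_mul h2 ha, fun _ => le_mul_of_one_le_left' h2⟩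
  exact key u hu k (h.lt.1.trans hu) e (h.lt.2.trans hu) h

/-- Comparison of the entries of two chains. -/
theorem Chain.compare {B a U K E B' a' U' K' E' : N} (hC : Chain B a U K E)
    (hC' : Chain B' a' U' K' E') (haa : a ≤ a') (ha : 1 ≤ a') {u k e u' k' e' : N} (hu : u < B)
    (hu' : u' < B') (h : Entry U K E u k e) (h' : Entry U' K' E' u' k' e') :
    (k ≤ k' → e ≤ e') ∧ (k < k' → a * e ≤ e') := by
  have key : ∀ u, u < B → ∀ k < B, ∀ e < B, ∀ u' < B', ∀ k' < B', ∀ e' < B',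
      Entry U K E u k e → Entry U' K' E' u' k' e' →
      (k ≤ k' → e ≤ e') ∧ (k < k' → a * e ≤ e') := by
    -- Induction on the position in the first chain, comparing the predecessors in both. The strict
    -- half, which gains a factor `a`, is needed when `k` is odd and `k'` even.
    refine hI.strong (P := fun _ u => u < B → ∀ k < B, ∀ e < B, ∀ u' < B', ∀ k' < B', ∀ e' < B',
      Entry U K E u k e → Entry U' K' E' u' k' e' →
      (k ≤ k' → e ≤ e') ∧ (k < k' → a * e ≤ e')) ?_ (fun _ => 0) ?_
    · exact .imp (.lt (.var 0) (.const B)) <| .ball (.const B) <| .ball (.const B) <|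
        .ball (.const B') <| .ball (.const B') <| .ball (.const B') <| .imp
        (.entry (.const _) (.const _) (.const _) (.var 5) (.var 4) (.var 3)) <| .imp
        (.entry (.const _) (.const _) (.const _) (.var 2) (.var 1) (.var 0)) <| .and
        (.imp (.le (.var 4) (.var 1)) (.le (.var 3) (.var 0)))
        (.imp (.lt (.var 4) (.var 1)) (.le (.mul (.const a) (.var 3)) (.var 0)))
    · intro u ih hu k hk e he u' hu' k' hk' e' he' h h'
      obtain ⟨h1, h2⟩ := hC'.le_entry hI ha hu' h'
      rcases hC u hu k hk e he h with
        ⟨rfl, rfl⟩ | ⟨v, hv, j, hj, d, hd, hE, hstep⟩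
      · exact ⟨fun _ => h1, fun h3 => by rw [mul_one]; exact haa.trans (h2 h3)⟩
      rcases hC' u' hu' k' hk' e' he' h' with
        ⟨rfl, rfl⟩ | ⟨v', hv', j', hj', d', hd', hE', hstep'⟩
      -- If the second entry is initial, only `k = 0` is left, and then both values are 1.
      · refine ⟨fun h3 => ?_, fun h3 => absurd h3 (not_lt.2 zero_le)⟩
        obtain rfl := le_antisymm h3 zero_le
        exact (hC.eq_one hI hu h).le
      obtain ⟨h3, h4⟩ := ih v hv (hv.trans hu) j hj d hd v' (hv'.trans hu') j' hj' d' hd' hE hE'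
      rcases hstep with ⟨rfl, rfl⟩ | ⟨rfl, rfl⟩ <;> rcases hstep' with ⟨rfl, rfl⟩ | ⟨rfl, rfl⟩
      · refine ⟨fun h5 => ?_, fun h5 => ?_⟩
        · have h6 := h3 (le_of_double_le (h5.trans le_self_add))
          exact mul_le_mul' h6 h6
        · have h6 := lt_of_double_lt h5
          calc a * (d * d) = (a * d) * d := by ring
            _ ≤ _ := mul_le_mul' (h4 h6) (h3 h6.le)
      · have h6 : j + j ≤ j' + j' + 1 → d * d ≤ d' * d' := fun h5 =>
          have h7 := h3 (le_of_double_le h5)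
          mul_le_mul' h7 h7
        refine ⟨fun h5 => (h6 h5).trans (le_mul_of_one_le_right' ha), fun h5 => ?_⟩
        rw [mul_comm]
        exact mul_le_mul' (h6 h5.le) haa
      -- Odd against even: here `j < j'`, and `a * d ≤ d'` absorbs the extra factor.
      · have h6 : j + j + 1 ≤ j' + j' → j < j' := fun h5 =>
          lt_of_double_lt (succ_le_iff'.1 h5)
        refine ⟨fun h5 => ?_, fun h5 => ?_⟩
        · calc d * d * a = (a * d) * d := by ring
            _ ≤ _ := mul_le_mul' (h4 (h6 h5)) (h3 (h6 h5).le)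
        · calc a * (d * d * a) = (a * d) * (a * d) := by ring
            _ ≤ _ := mul_le_mul' (h4 (h6 h5.le)) (h4 (h6 h5.le))
      · refine ⟨fun h5 => ?_, fun h5 => ?_⟩
        · have h6 := h3 (le_of_double_le (le_self_add.trans h5))
          exact mul_le_mul' (mul_le_mul' h6 h6) haa
        · have h6 := lt_of_double_lt (lt_of_add_lt_add_right h5)
          calc a * (d * d * a) = (a * d) * d * a := by ring
            _ ≤ _ := mul_le_mul' (mul_le_mul' (h4 h6) (h3 h6.le)) haa
  exact key u hu k (h.lt.1.trans hu) e (h.lt.2.trans hu) u' hu' k' (h'.lt.1.trans hu') e'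
    (h'.lt.2.trans hu') h h'

/-- The code bounds `B` and `B'` are unrelated; the comparison uses the chains and not the size of
their codes. -/
theorem PowRel.compare {B a k y B' a' k' y' : N} (h : PowRel B a k y) (h' : PowRel B' a' k' y')
    (haa : a ≤ a') (ha : 1 ≤ a') : (k ≤ k' → y ≤ y') ∧ (k < k' → a * y ≤ y') := by
  obtain ⟨U, -, K, -, E, -, hC, u, hu, hE⟩ := h
  obtain ⟨U', -, K', -, E', -, hC', u', hu', hE'⟩ := h'
  exact hC.compare hI hC' haa ha hu hu' hE hE'

theorem PowRel.eq_one {B a y : N} (h : PowRel B a 0 y) : y = 1 := by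
  obtain ⟨U, -, K, -, E, -, hC, u, hu, hE⟩ := h
  exact hC.eq_one hI hu hE

/-- The function `x ↦ x ^ len x` is monotone. -/
theorem OmegaRel.le {x y a c : N} (h : OmegaRel x y) (h' : OmegaRel a c) (hxa : x ≤ a) :
    y ≤ c := by
  obtain ⟨k, hk, p, hp, hxp, hpow, hy⟩ := h
  obtain ⟨l, hl, q, hq, haq, hqow, hc⟩ := h'
  -- The comparison of powers requires base at least 1, so `a = 0` is treated apart; there both
  -- exponents are 0.
  rcases (zero_le (a := a)).eq_or_lt with rfl | ha
  · obtain rfl := le_antisymm hxa zero_le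
    obtain rfl := le_antisymm (lt_succ_iff.1 hk) zero_le
    obtain rfl := le_antisymm (lt_succ_iff.1 hl) zero_le
    rw [hy.eq_one hI, hc.eq_one hI]
  · refine (hy.compare hI hc hxa ?_).1 ?_
    · simpa using succ_le_iff'.2 ha
    -- If `l < k` then `2 q ≤ p`. But `x ≤ a < q` gives `2 x + 2 ≤ 2 q`, against `p < 2 x + 2`.
    · by_contra hlk
      have h1 := (hqow.compare hI hpow le_rfl (by simp)).2 (not_le.1 hlk)
      have h2 := succ_le_iff'.2 (hxa.trans_lt haq)
      have h3 : x + x + 1 + 1 ≤ (1 + 1) * q := by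
        calc x + x + 1 + 1 = (x + 1) + (x + 1) := by ring
          _ ≤ q + q := add_le_add h2 h2
          _ = _ := by ring
      exact absurd hp (not_lt.2 (h3.trans h1))

end

/-! ### Adding a function symbol for a monotone function with a bounded graph -/

section

variable {N : Type} [DiscreteSemiring N]

/-- The function `g`, cut off at `w`. -/
def truncate (g : N → N) (w x : N) : N := if g x ≤ w then g x else 0

variable {g : N → N}

/-- The parameter `w` replaces a polynomial bound, which `g` need not have. The test `g x ≤ w` is
bounded because it says that some `z < w + 1` equals `g x`. -/
theorem isGood_truncate (hd : IsDef ∅ fun v : ℕ → N => v 0 = g (v 1)) (w : N) :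
    IsGood ∅ fun v => truncate g w (v 0) := by
  refine ⟨⟨_, .const w, fun v => ?_⟩, ?_⟩
  · unfold truncate
    split_ifs with h
    · exact h
    · exact zero_le
  · have h1 : IsDef ∅ fun v : ℕ → N => ∃ z < w + 1, z = g (v 1) :=
      .bex (P := fun v z => z = g (v 1)) (.const (w + 1)) <|
        hd.subst_term (σ := fun v => cons (v 0) fun _ => v 2) (IsTm.extend (.var 0) fun _ => .var 2)
    refine ((h1.and hd).or (h1.not.and (.eq (.var 0) (.const 0)))).of_iff fun v => ?_
    have h2 : (∃ z < w + 1, z = g (v 1)) ↔ g (v 1) ≤ w := by simp [lt_succ_iff]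
    simp only [h2, tail, truncate]
    split_ifs with h3 <;> simp [h3]

/-- A term with `g` agrees, below given bounds, with a good function in which `g` is cut off. -/
theorem IsTm.exists_truncate (hg : Monotone g) (hd : IsDef ∅ fun v : ℕ → N => v 0 = g (v 1))
    {t : (ℕ → N) → N} (ht : IsTm {g} t) :
    ∃ s : N → (ℕ → N) → N, (∀ w, IsGood ∅ (s w)) ∧
      ∀ c, ∃ w₀ d, ∀ v ≤ c, t v ≤ d ∧ ∀ w, w₀ ≤ w → s w v = t v := by
  induction ht with
  | var i =>
    exact ⟨_, fun _ => (IsTm.var i).isGood, fun c => ⟨0, c i, fun v hv => ⟨hv i, fun _ _ => rfl⟩⟩⟩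
  | const a =>
    exact ⟨_, fun _ => (IsTm.const a).isGood, fun c => ⟨0, a, fun v hv => ⟨le_rfl, fun _ _ => rfl⟩⟩⟩
  | add _ _ h1 h2 =>
    obtain ⟨s1, hs1, h1⟩ := h1
    obtain ⟨s2, hs2, h2⟩ := h2
    refine ⟨_, fun w => (hs1 w).add (hs2 w), fun c => ?_⟩
    obtain ⟨w1, d1, h1⟩ := h1 c
    obtain ⟨w2, d2, h2⟩ := h2 c
    refine ⟨max w1 w2, d1 + d2, fun v hv => ⟨add_le_add (h1 v hv).1 (h2 v hv).1, fun w hw => ?_⟩⟩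
    rw [(h1 v hv).2 w ((le_max_left _ _).trans hw), (h2 v hv).2 w ((le_max_right _ _).trans hw)]
  | mul _ _ h1 h2 =>
    obtain ⟨s1, hs1, h1⟩ := h1
    obtain ⟨s2, hs2, h2⟩ := h2
    refine ⟨_, fun w => (hs1 w).mul (hs2 w), fun c => ?_⟩
    obtain ⟨w1, d1, h1⟩ := h1 c
    obtain ⟨w2, d2, h2⟩ := h2 c
    refine ⟨max w1 w2, d1 * d2, fun v hv => ⟨mul_le_mul' (h1 v hv).1 (h2 v hv).1, fun w hw => ?_⟩⟩
    rw [(h1 v hv).2 w ((le_max_left _ _).trans hw), (h2 v hv).2 w ((le_max_right _ _).trans hw)]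
  | @app g' f hmem _ h1 =>
    obtain rfl : g' = g := hmem
    obtain ⟨s1, hs1, h1⟩ := h1
    refine ⟨_, fun w => (isGood_truncate hd w).comp (by simp) (hs1 w), fun c => ?_⟩
    obtain ⟨w1, d1, h1⟩ := h1 c
    -- By monotonicity `g'` stays below `g' d1` on arguments up to `d1`, so a cut-off at or above
    -- `g' d1` has no effect there.
    refine ⟨max w1 (g' d1), g' d1, fun v hv => ⟨hg (h1 v hv).1, fun w hw => ?_⟩⟩
    rw [(h1 v hv).2 w ((le_max_left _ _).trans hw), truncate,
      if_pos ((hg (h1 v hv).1).trans ((le_max_right _ _).trans hw))]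

/-- Below `c` the formula evaluates `g` only at arguments below a fixed bound, so one large cut-off
serves for all of them. -/
theorem IsDef.exists_truncate (hg : Monotone g) (hd : IsDef ∅ fun v : ℕ → N => v 0 = g (v 1))
    {P : (ℕ → N) → Prop} (hP : IsDef {g} P) :
    ∃ Q : N → (ℕ → N) → Prop, (∀ w, IsDef ∅ (Q w)) ∧
      ∀ c, ∃ w₀, ∀ v ≤ c, ∀ w, w₀ ≤ w → (Q w v ↔ P v) := by
  induction hP with
  | falsum => exact ⟨_, fun _ => .falsum, fun c => ⟨0, fun _ _ _ _ => Iff.rfl⟩⟩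
  | eq h1 h2 =>
    obtain ⟨s1, hs1, h1⟩ := h1.exists_truncate hg hd
    obtain ⟨s2, hs2, h2⟩ := h2.exists_truncate hg hd
    refine ⟨_, fun w => .eq_good (hs1 w) (hs2 w), fun c => ?_⟩
    obtain ⟨w1, d1, h1⟩ := h1 c
    obtain ⟨w2, d2, h2⟩ := h2 c
    refine ⟨max w1 w2, fun v hv w hw => ?_⟩
    rw [(h1 v hv).2 w ((le_max_left _ _).trans hw), (h2 v hv).2 w ((le_max_right _ _).trans hw)]
  | lt h1 h2 =>
    obtain ⟨s1, hs1, h1⟩ := h1.exists_truncate hg hd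
    obtain ⟨s2, hs2, h2⟩ := h2.exists_truncate hg hd
    refine ⟨_, fun w => .lt_good (hs1 w) (hs2 w), fun c => ?_⟩
    obtain ⟨w1, d1, h1⟩ := h1 c
    obtain ⟨w2, d2, h2⟩ := h2 c
    refine ⟨max w1 w2, fun v hv w hw => ?_⟩
    rw [(h1 v hv).2 w ((le_max_left _ _).trans hw), (h2 v hv).2 w ((le_max_right _ _).trans hw)]
  | imp _ _ h1 h2 =>
    obtain ⟨Q1, hQ1, h1⟩ := h1
    obtain ⟨Q2, hQ2, h2⟩ := h2
    refine ⟨_, fun w => (hQ1 w).imp (hQ2 w), fun c => ?_⟩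
    obtain ⟨w1, h1⟩ := h1 c
    obtain ⟨w2, h2⟩ := h2 c
    refine ⟨max w1 w2, fun v hv w hw => ?_⟩
    rw [h1 v hv w ((le_max_left _ _).trans hw), h2 v hv w ((le_max_right _ _).trans hw)]
  | @ball' f P h1 _ h2 =>
    obtain ⟨s1, hs1, h1⟩ := h1.exists_truncate hg hd
    obtain ⟨Q2, hQ2, h2⟩ := h2
    refine ⟨_, fun w => .ball_good (P := fun v z => Q2 w (cons z v)) (hs1 w)
      ((hQ2 w).of_iff fun v => by rw [cons_tail]), fun c => ?_⟩
    obtain ⟨w1, d1, h1⟩ := h1 c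
    -- The quantified variable stays below the value of its bound, hence below `d1`.
    obtain ⟨w2, h2⟩ := h2 (cons d1 c)
    refine ⟨max w1 w2, fun v hv w hw => ?_⟩
    rw [(h1 v hv).2 w ((le_max_left _ _).trans hw)]
    refine forall₂_congr fun z hz => h2 _ ?_ w ((le_max_right _ _).trans hw)
    intro i
    cases i with
    | zero => exact hz.le.trans (h1 v hv).1
    | succ i => exact hv i

/-- To reach `z` only arguments up to `z` matter. There `P` agrees with a predicate `Q w` free of
`g`, and the given induction applies to `y ≤ z → Q w y`. -/
theorem HasInd.expand (hI : HasInd (∅ : Set (N → N))) (hg : Monotone g)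
    (hd : IsDef ∅ fun v : ℕ → N => v 0 = g (v 1)) : HasInd {g} := by
  intro P hP v h0 hs z
  obtain ⟨Q, hQ, h⟩ := IsDef.exists_truncate hg hd hP
  obtain ⟨w, h⟩ := h (cons z v)
  have h' : ∀ y ≤ z, (Q w (cons y v) ↔ P (cons y v)) := fun y hy => by
    refine h _ (fun i => ?_) w le_rfl
    cases i with
    | zero => exact hy
    | succ i => exact le_rfl
  have key := hI (fun u => u 0 ≤ z → Q w u) (.imp (.le (.var 0) (.const z)) (hQ w)) v
    (fun h1 => (h' _ h1).2 h0) fun y hy h1 =>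
      (h' _ h1).2 (hs y ((h' y (le_self_add.trans h1)).1 (hy (le_self_add.trans h1))))
  exact (h' z le_rfl).1 (key z le_rfl)

/-- If all numbers `x ^ len x` exist, then there is a monotone function `x ↦ x ^ len x`, for which
induction holds. -/
theorem HasInd.exists_om (hI : HasInd (∅ : Set (N → N))) (H : ∀ x : N, ∃ y, OmegaRel x y) :
    ∃ om : N → N, (∀ x, OmegaRel x (om x)) ∧ HasInd (symbols true om) := by
  choose om hom using H
  refine ⟨om, hom, ?_⟩
  have e : symbols true om = {om} := by
    ext g
    simp [symbols]
  rw [e]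
  refine hI.expand (fun x a hxa => (hom x).le hI (hom a) hxa) ?_
  -- Monotonicity in both directions gives uniqueness, so `OmegaRel` is exactly the graph of `om`.
  refine (IsDef.omegaRel (.var 1) (.var 0)).of_iff fun v => ⟨fun h => h ▸ hom _, fun h => ?_⟩
  exact le_antisymm (h.le hI (hom _) le_rfl) ((hom _).le hI h le_rfl)

end

/-! ### Semantics of the three-sorted language -/

namespace HOStructure

section

variable (M : HOStructure) {vn vn' : ℕ → M.N} {vf vf' : ℕ → M.Fn} {vo vo' : ℕ → M.Op}

theorem evalF_congr : ∀ (t : FTerm), (∀ i, t.UsesF i → vf i = vf' i) →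
    (∀ i, t.UsesO i → vo i = vo' i) → M.evalF vf vo t = M.evalF vf' vo' t
  | .var i, hf, _ => hf i rfl
  | .op F g, hf, ho => by
    rw [evalF, evalF, ho F (.inl rfl), evalF_congr g hf fun i hi => ho i (.inr hi)]

theorem evalN_congr : ∀ (t : NTerm), (∀ i, t.UsesN i → vn i = vn' i) →
    (∀ i, t.UsesF i → vf i = vf' i) → (∀ i, t.UsesO i → vo i = vo' i) →
    M.evalN vn vf vo t = M.evalN vn' vf' vo' t
  | .var i, hn, _, _ => hn i rfl
  | .zero, _, _, _ => rfl
  | .one, _, _, _ => rfl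
  | .add t s, hn, hf, ho => by
    rw [evalN, evalN, evalN_congr t (fun i hi => hn i (.inl hi)) (fun i hi => hf i (.inl hi))
      fun i hi => ho i (.inl hi), evalN_congr s (fun i hi => hn i (.inr hi))
      (fun i hi => hf i (.inr hi)) fun i hi => ho i (.inr hi)]
  | .mul t s, hn, hf, ho => by
    rw [evalN, evalN, evalN_congr t (fun i hi => hn i (.inl hi)) (fun i hi => hf i (.inl hi))
      fun i hi => ho i (.inl hi), evalN_congr s (fun i hi => hn i (.inr hi))
      (fun i hi => hf i (.inr hi)) fun i hi => ho i (.inr hi)]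
  | .om t, hn, hf, ho => by rw [evalN, evalN, evalN_congr t hn hf ho]
  | .ap g t, hn, hf, ho => by
    rw [evalN, evalN, evalN_congr t hn (fun i hi => hf i (.inr hi)) fun i hi => ho i (.inr hi),
      M.evalF_congr g (fun i hi => hf i (.inl hi)) fun i hi => ho i (.inl hi)]

/-- Satisfaction depends only on the values of the free variables. -/
theorem sat_congr (φ : Fml) : ∀ {vn vn' : ℕ → M.N} {vf vf' : ℕ → M.Fn} {vo vo' : ℕ → M.Op},
    (∀ i, φ.UsesN i → vn i = vn' i) → (∀ i, φ.UsesF i → vf i = vf' i) →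
    (∀ i, φ.UsesO i → vo i = vo' i) → (M.Sat vn vf vo φ ↔ M.Sat vn' vf' vo' φ) := by
  have upd : ∀ {α : Type} {v v' : ℕ → α} (x : ℕ) (a : α) {U : ℕ → Prop},
      (∀ i, x ≠ i ∧ U i → v i = v' i) →
      ∀ i, U i → Function.update v x a i = Function.update v' x a i := by
    intro α v v' x a U h i hi
    by_cases hx : i = x
    · subst hx
      simp
    · simp [hx, h i ⟨Ne.symm hx, hi⟩]
  induction φ with
  | falsum => exact fun _ _ _ => Iff.rfl
  | eq t s =>
    intro _ _ _ _ _ _ hn hf ho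
    rw [Sat, Sat, M.evalN_congr t (fun i hi => hn i (.inl hi)) (fun i hi => hf i (.inl hi))
      fun i hi => ho i (.inl hi), M.evalN_congr s (fun i hi => hn i (.inr hi))
      (fun i hi => hf i (.inr hi)) fun i hi => ho i (.inr hi)]
  | lt t s =>
    intro _ _ _ _ _ _ hn hf ho
    rw [Sat, Sat, M.evalN_congr t (fun i hi => hn i (.inl hi)) (fun i hi => hf i (.inl hi))
      fun i hi => ho i (.inl hi), M.evalN_congr s (fun i hi => hn i (.inr hi))
      (fun i hi => hf i (.inr hi)) fun i hi => ho i (.inr hi)]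
  | imp φ ψ h1 h2 =>
    intro _ _ _ _ _ _ hn hf ho
    rw [Sat, Sat, h1 (fun i hi => hn i (.inl hi)) (fun i hi => hf i (.inl hi))
      fun i hi => ho i (.inl hi), h2 (fun i hi => hn i (.inr hi))
      (fun i hi => hf i (.inr hi)) fun i hi => ho i (.inr hi)]
  | allN x φ h1 =>
    intro _ _ _ _ _ _ hn hf ho
    exact forall_congr' fun a => h1 (upd x a hn) hf ho
  | allF x φ h1 =>
    intro _ _ _ _ _ _ hn hf ho
    exact forall_congr' fun a => h1 hn (upd x a hf) ho
  | allO x φ h1 =>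
    intro _ _ _ _ _ _ hn hf ho
    exact forall_congr' fun a => h1 hn hf (upd x a ho)

theorem evalN_updateN {t : NTerm} {x : ℕ} (h : ¬ t.UsesN x) (a : M.N) :
    M.evalN (Function.update vn x a) vf vo t = M.evalN vn vf vo t :=
  M.evalN_congr t (fun _ hi => Function.update_of_ne (by rintro rfl; exact h hi) _ _)
    (fun _ _ => rfl) fun _ _ => rfl

theorem evalN_updateF {t : NTerm} {x : ℕ} (h : ¬ t.UsesF x) (a : M.Fn) :
    M.evalN vn (Function.update vf x a) vo t = M.evalN vn vf vo t :=
  M.evalN_congr t (fun _ _ => rfl)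
    (fun _ hi => Function.update_of_ne (by rintro rfl; exact h hi) _ _) fun _ _ => rfl

theorem evalN_updateO {t : NTerm} {x : ℕ} (h : ¬ t.UsesO x) (a : M.Op) :
    M.evalN vn vf (Function.update vo x a) t = M.evalN vn vf vo t :=
  M.evalN_congr t (fun _ _ => rfl) (fun _ _ => rfl)
    fun _ hi => Function.update_of_ne (by rintro rfl; exact h hi) _ _

theorem sat_updateN {φ : Fml} {x : ℕ} (h : ¬ φ.UsesN x) (a : M.N) :
    M.Sat (Function.update vn x a) vf vo φ ↔ M.Sat vn vf vo φ :=
  M.sat_congr φ (fun _ hi => Function.update_of_ne (by rintro rfl; exact h hi) _ _)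
    (fun _ _ => rfl) fun _ _ => rfl

theorem sat_updateF {φ : Fml} {x : ℕ} (h : ¬ φ.UsesF x) (a : M.Fn) :
    M.Sat vn (Function.update vf x a) vo φ ↔ M.Sat vn vf vo φ :=
  M.sat_congr φ (fun _ _ => rfl)
    (fun _ hi => Function.update_of_ne (by rintro rfl; exact h hi) _ _) fun _ _ => rfl

theorem sat_updateO {φ : Fml} {x : ℕ} (h : ¬ φ.UsesO x) (a : M.Op) :
    M.Sat vn vf (Function.update vo x a) φ ↔ M.Sat vn vf vo φ :=
  M.sat_congr φ (fun _ _ => rfl) (fun _ _ => rfl)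
    fun _ hi => Function.update_of_ne (by rintro rfl; exact h hi) _ _

theorem sat_neg (φ : Fml) : M.Sat vn vf vo φ.neg ↔ ¬ M.Sat vn vf vo φ := Iff.rfl

theorem sat_and (φ ψ : Fml) :
    M.Sat vn vf vo (φ.and ψ) ↔ M.Sat vn vf vo φ ∧ M.Sat vn vf vo ψ := by
  simp only [Fml.and, Fml.neg, Sat]
  tauto

theorem sat_exN (x : ℕ) (φ : Fml) :
    M.Sat vn vf vo (φ.exN x) ↔ ∃ a, M.Sat (Function.update vn x a) vf vo φ := by
  simp only [Fml.exN, Fml.neg, Sat]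
  exact not_forall_not

theorem sat_exF (x : ℕ) (φ : Fml) :
    M.Sat vn vf vo (φ.exF x) ↔ ∃ a, M.Sat vn (Function.update vf x a) vo φ := by
  simp only [Fml.exF, Fml.neg, Sat]
  exact not_forall_not

theorem sat_exO (x : ℕ) (φ : Fml) :
    M.Sat vn vf vo (φ.exO x) ↔ ∃ a, M.Sat vn vf (Function.update vo x a) φ := by
  simp only [Fml.exO, Fml.neg, Sat]
  exact not_forall_not

/-- The arithmetical operations on the numbers. -/
def ops : ArithOps M.N where
  zero := M.zero
  one := M.one
  add := M.add
  mul := M.mul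
  om := M.om
  lt := M.lt

/-! ### First-order formulas interpreted over the sort of numbers. -/

section FirstOrder

variable {b : Bool} [(arith b).Structure M.N] (h : M.ops.Interprets b)
include h

theorem evalN_ofTerm (w : Empty → M.N) {n : ℕ} (t : Tm b n) :
    M.evalN vn vf vo (ofTerm t) = t.realize (Sum.elim w fun i : Fin n => vn i) := by
  induction t with
  | var i =>
    rcases i with i | i
    · exact i.elim
    · rfl
  | func c ts ih =>
    rw [Term.realize, h.func]
    cases c with
    | zero => rfl
    | one => rfl
    | add => exact congrArg₂ M.add (ih 0) (ih 1)
    | mul => exact congrArg₂ M.mul (ih 0) (ih 1)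
    | om => exact congrArg M.om (ih 0)

theorem sat_ofFm (w : Empty → M.N) {n : ℕ} (φ : Fm b n) : ∀ {vn : ℕ → M.N},
    M.Sat vn vf vo (ofFm φ) ↔ φ.Realize w fun i : Fin n => vn i := by
  induction φ with
  | falsum => exact Iff.rfl
  | equal t s =>
    intro vn
    exact iff_of_eq (congrArg₂ _ (M.evalN_ofTerm h w t) (M.evalN_ofTerm h w s))
  | rel R ts =>
    intro vn
    rw [BoundedFormula.Realize, h.rel]
    cases R with
    | lt => exact iff_of_eq (congrArg₂ M.lt (M.evalN_ofTerm h w _) (M.evalN_ofTerm h w _))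
  | imp _ _ h1 h2 => exact imp_congr h1 h2
  | @all n φ h1 =>
    intro vn
    -- The bound variable has index `n`, so updating `vn` at `n` extends the tuple at its end.
    refine forall_congr' fun a => h1.trans (iff_of_eq (congrArg _ ?_))
    funext i
    refine Fin.lastCases ?_ (fun i => ?_) i
    · simp
    · simp [Function.update_of_ne i.2.ne]

theorem models_ofFm (σ : (arith b).Sentence) : M.Models (ofFm σ) ↔ M.N ⊨ σ := by
  have key := fun vn vf vo => M.sat_ofFm (vn := vn) (vf := vf) (vo := vo) h default σ
  obtain ⟨f⟩ := M.nonempty_Fn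
  obtain ⟨F⟩ := M.nonempty_Op
  have e : ∀ vn : ℕ → M.N, (fun i : Fin 0 => vn i) = default := fun _ => Subsingleton.elim _ _
  constructor
  · intro H
    have h1 := (key (fun _ => M.zero) (fun _ => f) (fun _ => F)).1 (H _ _ _)
    exact (congrArg (BoundedFormula.Realize σ default) (e fun _ => M.zero)).mp h1
  · intro H vn vf vo
    rw [key, e]
    exact H

end FirstOrder

end

end HOStructure

/-- With `usesN_ofFm` this supplies the variable conditions: `n` is absent from the bound of the
quantifier that binds it, and `n + 1` is fresh in the induction axiom. -/
theorem usesN_ofTerm {b : Bool} {n i : ℕ} (t : Tm b n) (h : (ofTerm t).UsesN i) : i < n := by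
  induction t with
  | var j =>
    rcases j with j | j
    · exact j.elim
    · exact lt_of_eq_of_lt (Eq.symm h) j.2
  | func c ts ih =>
    cases c with
    | zero => exact h.elim
    | one => exact h.elim
    | add => exact h.elim (ih 0) (ih 1)
    | mul => exact h.elim (ih 0) (ih 1)
    | om => exact ih 0 h

theorem usesN_ofFm {b : Bool} {n i : ℕ} (φ : Fm b n) (h : (ofFm φ).UsesN i) : i < n := by
  induction φ with
  | falsum => exact h.elim
  | equal t s => exact h.elim (usesN_ofTerm t) (usesN_ofTerm s)
  | rel R ts =>
    cases R with
    | lt => exact h.elim (usesN_ofTerm _) (usesN_ofTerm _)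
  | imp _ _ h1 h2 => exact h.elim h1 h2
  | all _ h1 => exact lt_of_le_of_ne (Nat.lt_succ_iff.1 (h1 h.2)) (Ne.symm h.1)

theorem ofTerm_up {b : Bool} {n : ℕ} (t : Tm b n) : ofTerm (up t) = ofTerm t := by
  induction t with
  | var i =>
    rcases i with i | i
    · exact i.elim
    · rfl
  | func c ts ih =>
    cases c with
    | zero => rfl
    | one => rfl
    | add => exact congrArg₂ NTerm.add (ih 0) (ih 1)
    | mul => exact congrArg₂ NTerm.mul (ih 0) (ih 1)
    | om => exact congrArg NTerm.om (ih 0)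

theorem IsDelta0.isBdd {b : Bool} {n : ℕ} {φ : Fm b n} (h : IsDelta0 φ) : IsBdd (ofFm φ) := by
  have hu : ∀ {n : ℕ} (t : Tm b n), ¬ (ofTerm (up t)).UsesN n := fun t ht =>
    lt_irrefl _ (usesN_ofTerm t (ofTerm_up t ▸ ht))
  induction h with
  | falsum => exact .falsum
  | equal t s => exact .eq _ _
  | lt t s => exact .lt _ _
  | imp _ _ h1 h2 => exact .imp h1 h2
  | ball t _ h1 => exact .allN _ _ (hu t) h1
  | bex t _ h1 => exact .exN _ _ (hu t) h1

/-! ### The model of functions and operators over a model of arithmetic -/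

namespace Good

variable (N : Type) [DiscreteSemiring N] (Ω : Set (N → N))

/-- Functions with a bounded graph that are bounded by a term. -/
abbrev Fn : Type := {f : N → N // IsGood Ω fun v => f (v 0)}

variable {N}

/-- Uniformly defined families of functions. -/
def IsGoodF (f : (ℕ → N) → Fn N Ω) : Prop := IsGood Ω fun v => (f (tail v)).1 (v 0)

variable (N) in
/-- Operators that preserve uniformly defined families of functions. -/
abbrev Op : Type := {F : Fn N Ω → Fn N Ω // ∀ f, IsGoodF Ω f → IsGoodF Ω fun v => F (f v)}

/-- Uniformly defined families of operators. -/
def IsGoodO (F : (ℕ → N) → Op N Ω) : Prop :=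
  ∀ σ : (ℕ → N) → ℕ → N, (∀ i, IsGood Ω fun v => σ v i) →
    ∀ f, IsGoodF Ω f → IsGoodF Ω fun v => (F (σ v)).1 (f v)

/-- The structure of numbers, functions and operators. -/
abbrev model (Ω : Set (N → N)) (om : N → N) : HOStructure where
  N := N
  Fn := Fn N Ω
  Op := Op N Ω
  zero := 0
  one := 1
  add := (· + ·)
  mul := (· * ·)
  om := om
  lt := (· < ·)
  ap f x := f.1 x
  op F f := F.1 f
  nonempty_Fn := ⟨⟨fun x => x, (IsTm.var 0).isGood⟩⟩
  nonempty_Op := ⟨⟨id, fun _ hf => hf⟩⟩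

/-- Uniformly defined families of assignments. -/
structure IsGoodEnv (vn : (ℕ → N) → ℕ → N) (vf : (ℕ → N) → ℕ → Fn N Ω)
    (vo : (ℕ → N) → ℕ → Op N Ω) : Prop where
  num : ∀ i, IsGood Ω fun v => vn v i
  fn : ∀ i, IsGoodF Ω fun v => vf v i
  op : ∀ i, IsGoodO Ω fun v => vo v i

variable {Ω} {om : N → N} {vn : (ℕ → N) → ℕ → N} {vf : (ℕ → N) → ℕ → Fn N Ω}
  {vo : (ℕ → N) → ℕ → Op N Ω}

/-- Fixed parameters are uniform by the very definition of the sorts `Fn` and `Op`. -/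
theorem IsGoodEnv.const (vn : ℕ → N) (vf : ℕ → Fn N Ω) (vo : ℕ → Op N Ω) :
    IsGoodEnv Ω (fun _ => vn) (fun _ => vf) fun _ => vo :=
  ⟨fun _ => (IsTm.const _).isGood, fun i => (vf i).2, fun i _ _ f hf => (vo i).2 f hf⟩

theorem IsGoodEnv.updateN (h : IsGoodEnv Ω vn vf vo)
    (x : ℕ) {f : (ℕ → N) → N} (hf : IsGood Ω f) :
    IsGoodEnv Ω (fun v => Function.update (vn v) x (f v)) vf vo := by
  refine ⟨fun i => ?_, h.fn, h.op⟩
  by_cases hi : i = x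
  · subst hi
    simpa using hf
  · simpa [hi] using h.num i

theorem IsGoodEnv.updateF (h : IsGoodEnv Ω vn vf vo)
    (x : ℕ) {f : (ℕ → N) → Fn N Ω}
    (hf : IsGoodF Ω f) : IsGoodEnv Ω vn (fun v => Function.update (vf v) x (f v)) vo := by
  refine ⟨h.num, fun i => ?_, h.op⟩
  by_cases hi : i = x
  · subst hi
    simpa using hf
  · simpa [hi] using h.fn i

theorem IsGoodEnv.updateO (h : IsGoodEnv Ω vn vf vo)
    (x : ℕ) {F : (ℕ → N) → Op N Ω}
    (hF : IsGoodO Ω F) : IsGoodEnv Ω vn vf (fun v => Function.update (vo v) x (F v)) := by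
  refine ⟨h.num, h.fn, fun i => ?_⟩
  by_cases hi : i = x
  · subst hi
    simpa using hF
  · simpa [hi] using h.op i

/-- Formulas that define bounded predicates under uniformly defined families of assignments. -/
def Uniform (Ω : Set (N → N)) (om : N → N) (φ : Fml) : Prop :=
  ∀ vn vf vo, IsGoodEnv Ω vn vf vo → IsDef Ω fun v => (model Ω om).Sat (vn v) (vf v) (vo v) φ

/-! ### Uniform assignments under substitution, and evaluation of terms. -/

variable (hΩ : ∀ g ∈ Ω, Monotone g)
include hΩ

theorem IsGoodF.subst {f : (ℕ → N) → Fn N Ω} (hf : IsGoodF Ω f) {σ : (ℕ → N) → ℕ → N}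
    (hσ : ∀ i, IsGood Ω fun v => σ v i) : IsGoodF Ω fun v => f (σ v) :=
  IsGood.subst hΩ hf (IsGood.lift hσ)

/-- The operator clause is why `IsGoodO` quantifies over substitutions: a further one is absorbed by
composition. -/
theorem IsGoodEnv.subst (h : IsGoodEnv Ω vn vf vo) {σ : (ℕ → N) → ℕ → N}
    (hσ : ∀ i, IsGood Ω fun v => σ v i) :
    IsGoodEnv Ω (fun v => vn (σ v)) (fun v => vf (σ v)) fun v => vo (σ v) where
  num i := (h.num i).subst hΩ hσ
  fn i := IsGoodF.subst hΩ (h.fn i) hσ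
  op i τ hτ f hf := h.op i (fun v => σ (τ v)) (fun i => (hσ i).subst hΩ hτ) f hf

theorem IsGoodEnv.weaken (h : IsGoodEnv Ω vn vf vo) :
    IsGoodEnv Ω (fun v => vn (tail v)) (fun v => vf (tail v)) fun v => vo (tail v) :=
  h.subst hΩ fun i => (IsTm.var (i + 1)).isGood

omit hΩ in
theorem isGoodF_evalF (h : IsGoodEnv Ω vn vf vo) (t : FTerm) :
    IsGoodF Ω fun v => (model Ω om).evalF (vf v) (vo v) t := by
  induction t with
  | var i => exact h.fn i
  | op F g ih => exact h.op F (fun v => v) (fun i => (IsTm.var i).isGood) _ ih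

variable (hom : om ∈ Ω)
include hom

theorem isGood_evalN (h : IsGoodEnv Ω vn vf vo) (t : NTerm) :
    IsGood Ω fun v => (model Ω om).evalN (vn v) (vf v) (vo v) t := by
  induction t with
  | var i => exact h.num i
  | zero => exact (IsTm.const 0).isGood
  | one => exact (IsTm.const 1).isGood
  | add _ _ h1 h2 => exact h1.add h2
  | mul _ _ h1 h2 => exact h1.mul h2
  | om _ h1 => exact IsGood.comp hΩ ((IsTm.var 0).app hom).isGood h1
  | ap g _ h1 =>
    -- The value is a good function of the argument `v 0` and the parameters; the value of the term
    -- is put for the argument.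
    exact IsGood.subst hΩ (isGoodF_evalF h g)
      (σ := fun v => cons ((model Ω om).evalN (vn v) (vf v) (vo v) _) v)
      (IsGood.extend h1 fun i => (IsTm.var i).isGood)

/-! ### Comprehension and the elimination of function and operator quantifiers. -/

variable (hI : HasInd Ω)
include hI

/-- The argument `n` is one more parameter, namely `v 0`, so a single minimization yields functions
that depend uniformly on all the others. -/
theorem isGood_value {φ : Fml} (hφ : Uniform Ω om φ) (h : IsGoodEnv Ω vn vf vo) (n m : ℕ)
    (T : NTerm) : IsGood Ω fun v => mu
      ((model Ω om).evalN (Function.update (vn (tail v)) n (v 0)) (vf (tail v)) (vo (tail v)) T)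
      fun b => (model Ω om).Sat (Function.update (Function.update (vn (tail v)) n (v 0)) m b)
        (vf (tail v)) (vo (tail v)) φ := by
  have h1 := (h.weaken hΩ).updateN n (IsTm.var 0).isGood
  refine hI.isGood_mu (P := fun v b => (model Ω om).Sat
    (Function.update (Function.update (vn (tail v)) n (v 0)) m b) (vf (tail v)) (vo (tail v)) φ)
    ?_ (isGood_evalN hΩ hom h1 T)
  exact hφ _ _ _ ((h1.weaken hΩ).updateN m (IsTm.var 0).isGood)

/-- The function `n ↦ μ(m < T(n) : φ(m, n))`. -/
noncomputable def defFn {φ : Fml} (hφ : Uniform Ω om φ) (n m : ℕ) (T : NTerm) (vn : ℕ → N)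
    (vf : ℕ → Fn N Ω) (vo : ℕ → Op N Ω) : Fn N Ω :=
  ⟨fun a => mu ((model Ω om).evalN (Function.update vn n a) vf vo T)
      fun b => (model Ω om).Sat (Function.update (Function.update vn n a) m b) vf vo φ,
    isGood_value hΩ hom hI hφ (IsGoodEnv.const vn vf vo) n m T⟩

theorem isGoodF_defFn {φ : Fml} (hφ : Uniform Ω om φ) (h : IsGoodEnv Ω vn vf vo) (n m : ℕ)
    (T : NTerm) : IsGoodF Ω fun v => defFn hΩ hom hI hφ n m T (vn v) (vf v) (vo v) :=
  isGood_value hΩ hom hI hφ h n m T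

/-- The operator that takes `f` to the function `n ↦ μ(m < T(n, f) : φ(m, n, f))`. -/
noncomputable def defOp {φ : Fml} (hφ : Uniform Ω om φ) (f n m : ℕ) (T : NTerm) (vn : ℕ → N)
    (vf : ℕ → Fn N Ω) (vo : ℕ → Op N Ω) : Op N Ω :=
  ⟨fun g => defFn hΩ hom hI hφ n m T vn (Function.update vf f g) vo, fun _ hg =>
    isGoodF_defFn hΩ hom hI hφ ((IsGoodEnv.const vn vf vo).updateF f hg) n m T⟩

/-- The substitution acts on the parameters of the definition only, while the argument `f` runs
through a family of its own; together they form one uniform assignment. -/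
theorem isGoodO_defOp {φ : Fml} (hφ : Uniform Ω om φ) (h : IsGoodEnv Ω vn vf vo) (f n m : ℕ)
    (T : NTerm) : IsGoodO Ω fun v => defOp hΩ hom hI hφ f n m T (vn v) (vf v) (vo v) :=
  fun _ hσ _ hg => isGoodF_defFn hΩ hom hI hφ ((h.subst hΩ hσ).updateF f hg) n m T

omit hΩ hom in
/-- The meaning of bounded minimization. -/
theorem sat_muF {φ : Fml} (hφ : Uniform Ω om φ) {r T : NTerm} {m : ℕ} (hr : ¬ r.UsesN m)
    (vn : ℕ → N) (vf : ℕ → Fn N Ω) (vo : ℕ → Op N Ω) :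
    (model Ω om).Sat vn vf vo (muF r m T φ) ↔
      (model Ω om).evalN vn vf vo r = mu ((model Ω om).evalN vn vf vo T)
        fun b => (model Ω om).Sat (Function.update vn m b) vf vo φ := by
  rw [← hI.isMu_iff (P := fun _ b => (model Ω om).Sat (Function.update vn m b) vf vo φ)
    (hφ _ _ _ ((IsGoodEnv.const vn vf vo).updateN m (IsTm.var 0).isGood)) (fun _ => 0)]
  have e : ∀ a : N, (model Ω om).evalN (Function.update vn m a) vf vo r =
      (model Ω om).evalN vn vf vo r := fun a => (model Ω om).evalN_updateN hr a
  have e' : ∀ a : N, (model Ω om).evalN (Function.update vn m a) vf vo (.var m) = a := fun a =>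
    Function.update_self ..
  rw [muF, HOStructure.sat_and, HOStructure.sat_and, HOStructure.sat_neg]
  refine and_congr Iff.rfl (and_congr (forall_congr' fun a => ?_)
    (imp_congr Iff.rfl (forall_congr' fun a => ?_)))
  · refine imp_congr (iff_of_eq ?_) Iff.rfl
    exact congrArg₂ (fun x y : N => x < y) (e' a) (e a)
  · refine imp_congr (iff_of_eq ?_) Iff.rfl
    exact congrArg₂ (fun x y : N => x = y) (e' a) (e a)

/-- The definition fixes every value of `g`, and functions with the same values are equal. Since `T`
and `φ` do not use `f`, the defining data do not depend on `g`. -/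
theorem sat_defF {φ : Fml} (hφ : Uniform Ω om φ) {f n m : ℕ} {T : NTerm} (hok : OkF f n m T φ)
    (vn : ℕ → N) (vf : ℕ → Fn N Ω) (vo : ℕ → Op N Ω) (g : Fn N Ω) :
    (model Ω om).Sat vn (Function.update vf f g) vo (defF f n m T φ) ↔
      g = defFn hΩ hom hI hφ n m T vn vf vo := by
  obtain ⟨hnm, hTm, hTf, hφf⟩ := hok
  rw [Subtype.ext_iff, funext_iff]
  refine forall_congr' fun a => ?_
  refine (sat_muF hI hφ (r := .ap (.var f) (.var n)) hnm _ _ _).trans ?_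
  have e1 : (model Ω om).evalN (Function.update vn n a) (Function.update vf f g) vo
      (.ap (.var f) (.var n)) = g.1 a := by
    change (Function.update vf f g f).1 (Function.update vn n a n) = _
    rw [Function.update_self, Function.update_self]
  have e2 := (model Ω om).evalN_updateF (vn := Function.update vn n a) (vf := vf) (vo := vo) hTf g
  have e3 : ∀ b : N, _ := fun b => propext ((model Ω om).sat_updateF
    (vn := Function.update (Function.update vn n a) m b) (vf := vf) (vo := vo) hφf g)
  exact iff_of_eq (congrArg₂ Eq e1 (congrArg₂ mu e2 (funext e3)))

/-- Operators are maps on the function sort, so the values `F(f)(n)` determine them. -/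
theorem sat_defO {φ : Fml} (hφ : Uniform Ω om φ) {F f n m : ℕ} {T : NTerm} (hok : OkO F n m T φ)
    (vn : ℕ → N) (vf : ℕ → Fn N Ω) (vo : ℕ → Op N Ω) (G : Op N Ω) :
    (model Ω om).Sat vn vf (Function.update vo F G) (defO F f n m T φ) ↔
      G = defOp hΩ hom hI hφ f n m T vn vf vo := by
  obtain ⟨hnm, hTm, hTF, hφF⟩ := hok
  rw [Subtype.ext_iff, funext_iff]
  refine forall_congr' fun g => ?_
  rw [Subtype.ext_iff, funext_iff]
  refine forall_congr' fun a => ?_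
  refine (sat_muF hI hφ (r := .ap (.op F (.var f)) (.var n)) hnm _ _ _).trans ?_
  have e1 : (model Ω om).evalN (Function.update vn n a) (Function.update vf f g)
      (Function.update vo F G) (.ap (.op F (.var f)) (.var n)) = (G.1 g).1 a := by
    change ((Function.update vo F G F).1 (Function.update vf f g f)).1
      (Function.update vn n a n) = _
    rw [Function.update_self, Function.update_self, Function.update_self]
  have e2 := (model Ω om).evalN_updateO (vn := Function.update vn n a)
    (vf := Function.update vf f g) (vo := vo) hTF G
  have e3 : ∀ b : N, _ := fun b => propext ((model Ω om).sat_updateO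
    (vn := Function.update (Function.update vn n a) m b) (vf := Function.update vf f g)
    (vo := vo) hφF G)
  exact iff_of_eq (congrArg₂ Eq e1 (congrArg₂ mu e2 (funext e3)))

/-- Bounded quantifier formulas define bounded predicates. -/
theorem uniform_of_isBdd {φ : Fml} (hφ : IsBdd φ) : Uniform Ω om φ := by
  have lt_iff : ∀ {z : ℕ} {S : NTerm}, ¬ S.UsesN z → ∀ (vn : ℕ → N) (vf : ℕ → Fn N Ω)
      (vo : ℕ → Op N Ω) (a : N),
      (model Ω om).Sat (Function.update vn z a) vf vo (.lt (.var z) S) ↔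
        a < (model Ω om).evalN vn vf vo S := fun {z S} hS vn vf vo a =>
    iff_of_eq (congrArg₂ (fun x y : N => x < y) (Function.update_self ..)
      ((model Ω om).evalN_updateN hS a))
  induction hφ with
  | falsum => exact fun _ _ _ _ => .falsum
  | eq t s => exact fun _ _ _ h => .eq_good (isGood_evalN hΩ hom h t) (isGood_evalN hΩ hom h s)
  | lt t s => exact fun _ _ _ h => .lt_good (isGood_evalN hΩ hom h t) (isGood_evalN hΩ hom h s)
  | imp _ _ h1 h2 => exact fun _ _ _ h => (h1 _ _ _ h).imp (h2 _ _ _ h)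
  | @allN z S φ hS _ h1 =>
    intro vn vf vo h
    refine (IsDef.ball_good
      (P := fun v a => (model Ω om).Sat (Function.update (vn v) z a) (vf v) (vo v) φ)
      (isGood_evalN hΩ hom h S)
      (h1 _ _ _ ((h.weaken hΩ).updateN z (IsTm.var 0).isGood))).of_iff fun v => ?_
    exact forall_congr' fun a => imp_congr (lt_iff hS _ _ _ a) Iff.rfl
  | @exN z S φ hS _ h1 =>
    intro vn vf vo h
    refine (IsDef.ball_good
      (P := fun v a => ¬ (model Ω om).Sat (Function.update (vn v) z a) (vf v) (vo v) φ)
      (isGood_evalN hΩ hom h S)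
      (h1 _ _ _ ((h.weaken hΩ).updateN z (IsTm.var 0).isGood)).not).not.of_iff fun v => ?_
    rw [HOStructure.sat_exN]
    push Not
    refine exists_congr fun a => ?_
    rw [HOStructure.sat_and]
    exact and_congr (lt_iff hS _ _ _ a) Iff.rfl
  | allF f n m T hok _ _ h1 h2 =>
    intro vn vf vo h
    -- The quantifier has exactly one instance, the defined function, so the formula asserts its
    -- body there. The remaining cases are alike.
    refine (h2 _ _ _ (h.updateF f (isGoodF_defFn hΩ hom hI h1 h n m T))).of_iff fun v => ?_
    refine Iff.trans (forall_congr' fun g =>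
      imp_congr (sat_defF hΩ hom hI h1 hok _ _ _ g) Iff.rfl) forall_eq
  | exF f n m T hok _ _ h1 h2 =>
    intro vn vf vo h
    refine (h2 _ _ _ (h.updateF f (isGoodF_defFn hΩ hom hI h1 h n m T))).of_iff fun v => ?_
    rw [HOStructure.sat_exF]
    exact (exists_congr fun g => (HOStructure.sat_and ..).trans
      (and_congr (sat_defF hΩ hom hI h1 hok _ _ _ g) Iff.rfl)).trans exists_eq_left
  | allO F f n m T hok _ _ h1 h2 =>
    intro vn vf vo h
    refine (h2 _ _ _ (h.updateO F (isGoodO_defOp hΩ hom hI h1 h f n m T))).of_iff fun v => ?_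
    refine Iff.trans (forall_congr' fun g =>
      imp_congr (sat_defO hΩ hom hI h1 hok _ _ _ g) Iff.rfl) forall_eq
  | exO F f n m T hok _ _ h1 h2 =>
    intro vn vf vo h
    refine (h2 _ _ _ (h.updateO F (isGoodO_defOp hΩ hom hI h1 h f n m T))).of_iff fun v => ?_
    rw [HOStructure.sat_exO]
    exact (exists_congr fun g => (HOStructure.sat_and ..).trans
      (and_congr (sat_defO hΩ hom hI h1 hok _ _ _ g) Iff.rfl)).trans exists_eq_left

/-- The axioms hold in the structure of numbers, functions and operators. -/
theorem models_axiom [(arith true).Structure N] (hS : (semiringOps N om).Interprets true)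
    (h : ∀ x, OmegaRel x (om x)) {ψ : Fml} (hψ : HOAxiom ψ) : (model Ω om).Models ψ := by
  have hS' : (model Ω om).ops.Interprets true := hS
  cases hψ with
  | basic σ hσ =>
    exact ((model Ω om).models_ofFm hS' σ).2 (hS.paMinus_iff.2 (isPA_semiringOps om) σ hσ)
  | omega =>
    refine ((model Ω om).models_ofFm hS' _).2 ?_
    change BoundedFormula.Realize omegaAx (default : Empty → N) default
    simp only [omegaAx, BoundedFormula.realize_all, realize_omegaF hS, hS.omT, realize_bv]
    exact fun a => h _
  | induction x k φ hφ hxk hk =>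
    intro vn vf vo
    have key := hI (fun v => (model Ω om).Sat (Function.update vn x (v 0)) vf vo φ)
      (uniform_of_isBdd hΩ hom hI hφ _ _ _
        ((IsGoodEnv.const vn vf vo).updateN x (IsTm.var 0).isGood)) (fun _ => 0)
    rw [HOStructure.Sat, HOStructure.sat_and]
    rintro ⟨h0, hs⟩
    refine key (h0 0 (Function.update_self ..)) fun z hz => ?_
    -- The auxiliary variable `k` of the axiom does not occur in `φ`, so its value may be discarded.
    have comm : ∀ a : N, (model Ω om).Sat (Function.update (Function.update vn k z) x a) vf vo φ ↔
        (model Ω om).Sat (Function.update vn x a) vf vo φ := fun a => by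
      rw [Function.update_comm (Ne.symm hxk)]
      exact (model Ω om).sat_updateN hk z
    have hk' : ∀ a : N, Function.update (Function.update vn k z) x a k = z := fun a => by
      rw [Function.update_of_ne (Ne.symm hxk), Function.update_self]
    have h1 := hs z fun a ha => by
      have h2 : a = z := by
        have h3 : Function.update (Function.update vn k z) x a x =
          Function.update (Function.update vn k z) x a k := ha
        rwa [hk', Function.update_self] at h3
      rw [h2]
      exact (comm z).2 hz
    refine (comm _).1 (h1 (z + 1) ?_)
    change Function.update (Function.update vn k z) x (z + 1) x =
      Function.update (Function.update vn k z) x (z + 1) k + 1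
    rw [hk', Function.update_self]
  | ext F f g n m =>
    intro vn vf vo hfg a
    have e : vf f = vf g := by
      refine Subtype.ext (funext fun a => ?_)
      have h1 : (vf f).1 (Function.update vn n a n) = (vf g).1 (Function.update vn n a n) := hfg a
      rwa [Function.update_self] at h1
    change ((vo F).1 (vf f)).1 _ = ((vo F).1 (vf g)).1 _
    rw [e]
  | compF f n m T φ hφ hok =>
    intro vn vf vo
    have h1 := uniform_of_isBdd hΩ hom hI hφ
    exact (HOStructure.sat_exF ..).2 ⟨_, (sat_defF hΩ hom hI h1 hok _ _ _ _).2 rfl⟩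
  | compO F f n m T φ hφ hok =>
    intro vn vf vo
    have h1 := uniform_of_isBdd hΩ hom hI hφ
    exact (HOStructure.sat_exO ..).2 ⟨_, (sat_defO hΩ hom hI h1 hok _ _ _ _).2 rfl⟩

end Good

/-! ### Conservativity -/

/-- Over a model of arithmetic with the function `x ↦ x ^ len x` there is a model of the theory of
functions and operators. -/
theorem models_axiom {N : Type} [DiscreteSemiring N] {om : N → N}
    (hI : HasInd (symbols true om)) (h : ∀ x, OmegaRel x (om x)) {ψ : Fml} (hψ : HOAxiom ψ) :
    (Good.model (symbols true om) om).Models ψ := by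
  let _ := (semiringOps N om).str true
  refine Good.models_axiom ?_ (show om ∈ symbols true om from ⟨rfl, rfl⟩) hI
    ((semiringOps N om).interprets_str true) h hψ
  rintro g ⟨-, rfl⟩ x y hxy
  exact (h x).le (hI.mono (Set.empty_subset _)) (h y) hxy

/-- Each model of the arithmetic is the number sort of a `Good.model`, where `σ` holds as a theorem;
and `σ` speaks of numbers only. -/
theorem models_of_hoTheorem_true {σ : (arith true).Sentence} (hσ : HOTheorem (ofFm σ)) :
    IDelta0Omega1Fun ⊨ᵇ σ := by
  rw [Theory.models_sentence_iff]
  intro M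
  have hM : ∀ τ ∈ IDelta0Omega1Fun, M ⊨ τ := fun τ hτ => Theory.realize_sentence_of_mem _ hτ
  -- `id` is a dummy: `om` is read off from the structure.
  have hS := ArithOps.interprets_ofStr true M id
  have hPA := hS.paMinus_iff.1 fun τ hτ => hM τ (.inl (.inl hτ))
  let _ := discreteSemiringOfIsPA hPA
  have hS : (semiringOps M (ArithOps.ofStr true M id).om).Interprets true := hS
  have hI := hasInd_of_models hS fun n φ hφ => hM _ (.inl (.inr ⟨n, φ, hφ, rfl⟩))
  have hom : ∀ x : M, OmegaRel x ((ArithOps.ofStr true M id).om x) := by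
    have h1 : BoundedFormula.Realize omegaAx (default : Empty → M) default :=
      hM _ (.inr rfl)
    simp only [omegaAx, BoundedFormula.realize_all, realize_omegaF hS, hS.omT, realize_bv] at h1
    exact h1
  exact (HOStructure.models_ofFm (Good.model _ _) hS σ).1
    (hσ _ fun ψ hψ => models_axiom hI hom hψ)

/-- Here `om` must first be constructed, from Ω₁ by `HasInd.exists_om`. -/
theorem models_of_hoTheorem_false {σ : (arith false).Sentence} (hσ : HOTheorem (ofFm σ)) :
    IDelta0Omega1 ⊨ᵇ σ := by
  rw [Theory.models_sentence_iff]
  intro M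
  have hM : ∀ τ ∈ IDelta0Omega1, M ⊨ τ := fun τ hτ => Theory.realize_sentence_of_mem _ hτ
  have hS := ArithOps.interprets_ofStr false M id
  have hPA := hS.paMinus_iff.1 fun τ hτ => hM τ (.inl (.inl hτ))
  let _ := discreteSemiringOfIsPA hPA
  -- The language has no symbol for `om`, so any function may take its place.
  have hS : ∀ om, (semiringOps M om).Interprets false := fun om =>
    { func := fun c xs => (hS.func c xs).trans (by cases c <;> rfl)
      rel := hS.rel }
  have hI := (hasInd_of_models (hS id) fun n φ hφ => hM _ (.inl (.inr ⟨n, φ, hφ, rfl⟩))).mono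
    (Set.empty_subset _)
  have hex : ∀ x : M, ∃ y, OmegaRel x y := by
    have h1 : BoundedFormula.Realize Omega1 (default : Empty → M) default := hM _ (.inr rfl)
    simp only [Omega1, BoundedFormula.realize_all, BoundedFormula.realize_ex,
      realize_omegaF (hS id), realize_bv] at h1
    exact h1
  obtain ⟨om, hom, hI⟩ := hI.exists_om hex
  exact (HOStructure.models_ofFm (Good.model _ _) (hS om) σ).1
    (hσ _ fun ψ hψ => models_axiom hI hom hψ)

/-! ### The numbers of a model of the three-sorted theory. -/

section Converse

variable {M : HOStructure} (hM : ∀ ψ, HOAxiom ψ → M.Models ψ)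
include hM

theorem isPA_ops : M.ops.IsPA := by
  let _ := M.ops.str true
  have h := M.ops.interprets_str true
  exact h.paMinus_iff.1 fun σ hσ => (M.models_ofFm h σ).1 (hM _ (.basic σ hσ))

/-- Translated Δ₀ formulas are bounded quantifier formulas, so the three-sorted induction scheme
covers them. -/
theorem models_iDelta0 {b : Bool} [(arith b).Structure M.N] (h : M.ops.Interprets b)
    {σ : (arith b).Sentence} (hσ : σ ∈ IDelta0 b) : M.N ⊨ σ := by
  rcases hσ with hσ | ⟨n, φ, hφ, rfl⟩
  · exact h.paMinus_iff.2 (isPA_ops hM) σ hσ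
  rw [realize_inductionAx_iff h]
  intro xs h0 hs z
  obtain ⟨f⟩ := M.nonempty_Fn
  obtain ⟨F⟩ := M.nonempty_Op
  -- The parameters occupy the variables below `n`; the default `M.zero` elsewhere is irrelevant.
  let vn : ℕ → M.N := fun i => if hi : i < n then xs ⟨i, hi⟩ else M.zero
  have key : ∀ (w : ℕ → M.N), (∀ i < n, w i = vn i) → ∀ a,
      (M.Sat (Function.update w n a) (fun _ => f) (fun _ => F) (ofFm φ) ↔
        φ.Realize default (Fin.snoc xs a : Fin (n + 1) → M.N)) := fun w hw a => by
    rw [M.sat_ofFm h default]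
    refine iff_of_eq (congrArg _ ?_)
    funext i
    refine Fin.lastCases ?_ (fun i => ?_) i
    · simp
    · simp [Function.update_of_ne i.2.ne, hw i i.2, vn]
  have hind := hM _ (.induction n (n + 1) (ofFm φ) hφ.isBdd (by omega)
    fun hu => lt_irrefl _ (usesN_ofFm φ hu)) vn (fun _ => f) fun _ => F
  rw [HOStructure.Sat, HOStructure.sat_and] at hind
  refine (key vn (fun _ _ => rfl) z).1 (hind ⟨fun a ha => ?_, fun k hk a ha => ?_⟩ z)
  · have ha : Function.update vn n a n = M.zero := ha
    rw [Function.update_self] at ha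
    rw [key vn fun _ _ => rfl, ha]
    exact h0
  · have hw : ∀ i < n, Function.update vn (n + 1) k i = vn i := fun i hi =>
      Function.update_of_ne (by omega) _ _
    have hn : ∀ a, Function.update (Function.update vn (n + 1) k) n a (n + 1) = k := fun a => by
      rw [Function.update_of_ne (by omega), Function.update_self]
    have ha : Function.update (Function.update vn (n + 1) k) n a n =
      M.add (Function.update (Function.update vn (n + 1) k) n a (n + 1)) M.one := ha
    rw [hn, Function.update_self] at ha
    rw [key _ hw, ha]
    refine hs k ((key _ hw k).1 (hk k ?_))
    change Function.update (Function.update vn (n + 1) k) n k n =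
      Function.update (Function.update vn (n + 1) k) n k (n + 1)
    rw [hn, Function.update_self]

theorem models_omegaAx [(arith true).Structure M.N] (h : M.ops.Interprets true) :
    M.N ⊨ omegaAx :=
  (M.models_ofFm h _).1 (hM _ .omega)

theorem models_omega1 [(arith false).Structure M.N] (h : M.ops.Interprets false) :
    M.N ⊨ Omega1 := by
  let _ := discreteSemiringOfIsPA (isPA_ops hM)
  have h : (semiringOps M.N M.om).Interprets false := h
  change BoundedFormula.Realize Omega1 (default : Empty → M.N) default
  simp only [Omega1, BoundedFormula.realize_all, BoundedFormula.realize_ex,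
    realize_omegaF h, realize_bv]
  -- `OmegaRel` is the meaning of the graph formula in both languages, so the value of `om` is a
  -- witness.
  have hex : ∀ x : M.N, ∃ y, OmegaRel x y := by
    let _ := M.ops.str true
    have h' : (semiringOps M.N M.om).Interprets true := M.ops.interprets_str true
    have h1 : BoundedFormula.Realize omegaAx (default : Empty → M.N) default :=
      models_omegaAx hM h'
    simp only [omegaAx, BoundedFormula.realize_all, realize_omegaF h', h'.omT, realize_bv] at h1
    exact fun x => ⟨_, h1 x⟩
  exact hex

end Converse

theorem hoTheorem_of_models_true {σ : (arith true).Sentence} (hσ : IDelta0Omega1Fun ⊨ᵇ σ) :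
    HOTheorem (ofFm σ) := by
  intro M hM
  let _ := M.ops.str true
  have h := M.ops.interprets_str true
  have : Nonempty M.N := ⟨M.zero⟩
  have : M.N ⊨ IDelta0Omega1Fun := (Theory.model_iff _).2 fun τ hτ => by
    rcases hτ with hτ | rfl
    · exact models_iDelta0 hM h hτ
    · exact models_omegaAx hM h
  exact (M.models_ofFm h σ).2 (hσ.realize_sentence M.N)

theorem hoTheorem_of_models_false {σ : (arith false).Sentence} (hσ : IDelta0Omega1 ⊨ᵇ σ) :
    HOTheorem (ofFm σ) := by
  intro M hM
  let _ := M.ops.str false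
  have h := M.ops.interprets_str false
  have : Nonempty M.N := ⟨M.zero⟩
  have : M.N ⊨ IDelta0Omega1 := (Theory.model_iff _).2 fun τ hτ => by
    rcases hτ with hτ | rfl
    · exact models_iDelta0 hM h hτ
    · exact models_omega1 hM h
  exact (M.models_ofFm h σ).2 (hσ.realize_sentence M.N)

end LimitedExp

theorem mainTheorem3 :
    (∀ σ : (LimitedExp.arith false).Sentence,
      LimitedExp.HOTheorem (LimitedExp.ofFm σ) ↔ LimitedExp.IDelta0Omega1 ⊨ᵇ σ) ∧
    (∀ σ : (LimitedExp.arith true).Sentence,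
      LimitedExp.HOTheorem (LimitedExp.ofFm σ) ↔ LimitedExp.IDelta0Omega1Fun ⊨ᵇ σ) :=
  ⟨fun _ => ⟨LimitedExp.models_of_hoTheorem_false, LimitedExp.hoTheorem_of_models_false⟩,
    fun _ => ⟨LimitedExp.models_of_hoTheorem_true, LimitedExp.hoTheorem_of_models_true⟩⟩
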